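/- Let $p$ be an odd prime, $m\ge 5$ an odd integer and $k$ a positive integer with $\gcd(m,k)=1$. Let $\mathrm{Tr}$ be the trace from $\mathbb F_{p^m}$ to $\mathbb F_p$, let $\zeta_p\in\mathbb C$ be a primitive $p$-th root of unity, and for $u,v,w\in\mathbb F_{p^m}$ put $$D(u,v,w)=\sum_{y\in\mathbb F_p^*}\ \sum_{x\in\mathbb F_{p^m}}\zeta_p^{\,y\,\mathrm{Tr}(ux^2+vx^{p^k+1}+wx^{p^{2k}+1})}.$$ For $a_1,a_2,b_1,b_2,c\in\mathbb F_{p^m}$ put $$S(a_1,a_2,b_1,b_2,c)=D(a_1+a_2,b_1+b_2,c)+D(a_1-a_2,b_1-b_2,c),$$ $$T(a_1,a_2,b_1,b_2,c)=D(a_1+a_2,b_1+b_2,c)+D(a_1-a_2,-(b_1-b_2),c).$$ For $\varepsilon=\pm1$ let $$n_0=(p^m-1)(p^m-p^{m-1}+1),\qquad n_\varepsilon=\tfrac12(p^m-1)\left(p^{m-1}+\varepsilon p^{\frac{m-1}2}\right),$$ $$n_0^*=p^{2m}-p^{2m-1}+p^{2m-4}-p^{m-3},$$ $$n_{\varepsilon,1}=\frac{(p^{m+2}-p^m-p^{m-1}+1)\left(p^{m-1}+\varepsilon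 p^{\frac{m-1}2}\right)}{2(p^2-1)},\qquad n_{\varepsilon,3}=\frac{(p^{m-1}-1)\left(p^{m-3}+\varepsilon p^{\frac{m-3}2}\right)}{2(p^2-1)}.$$ Then, for $\varepsilon=\pm1$, the numbers of $(u,v)\in\mathbb F_{p^m}^2$ with $D(u,v,0)=0$ and with $D(u,v,0)=\varepsilon(p-1)p^{\frac{m+1}2}$ are $n_0$ and $n_\varepsilon$, respectively; and for every fixed $w\in\mathbb F_{p^m}^*$ the numbers of $(u,v)\in\mathbb F_{p^m}^2$ with $D(u,v,w)=0$, with $D(u,v,w)=\varepsilon(p-1)p^{\frac{m+1}2}$ and with $D(u,v,w)=\varepsilon(p-1)p^{\frac{m+3}2}$ are $n_0^*$, $n_{\varepsilon,1}$ and $n_{\varepsilon,3}$, respectively. If $k$ is even, then, as $(a_1,a_2,b_1,b_2,c)$ runs through $\mathbb F_{p^m}^5$, the value distribution of $S(a_1,a_2,b_1,b_2,c)$ is given by the following table. If $k$ is odd, the value distribution of $T(a_1,a_2,b_1,b_2,c)$ is given by the same table. $$\begin{array}{ll} \text{Value}&\text{Frequency}\\ \hline 2(p-1)p^m & 1\\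 (p-1)p^m & 2n_0\\ (p-1)(p^m-p^{\frac{m+1}2}) & 2n_{-1}\\ (p-1)(p^m+p^{\frac{m+1}2}) & 2n_1\\ (p-1)p^{\frac{m+1}2} & 2n_0n_1+2(p^m-1)n_0^*n_{1,1}\\ (p-1)p^{\frac{m+3}2} & 2(p^m-1)n_0^*n_{1,3}\\ 2(p-1)p^{\frac{m+1}2} & n_1^2+(p^m-1)n_{1,1}^2\\ 2(p-1)p^{\frac{m+3}2} & (p^m-1)n_{1,3}^2\\ -(p-1)p^{\frac{m+1}2} & 2n_0n_{-1}+2(p^m-1)n_0^*n_{-1,1}\\ -(p-1)p^{\frac{m+3}2} & 2(p^m-1)n_0^*n_{-1,3}\\ -2(p-1)p^{\frac{m+1}2} & n_{-1}^2+(p^m-1)n_{-1,1}^2\\ -2(p-1)p^{\frac{m+3}2} & (p^m-1)n_{-1,3}^2\\ (p-1)(p^{\frac{m+1}2}+p^{\frac{m+3}2}) & 2(p^m-1)n_{1,1}n_{1,3}\\ (p-1)(p^{\frac{m+1}2}-p^{\frac{m+3}2}) & 2(p^m-1)n_{1,1}n_{-1,3}\\ (p-1)(-p^{\frac{m+1}2}+p^{\frac{m+3}2})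 & 2(p^m-1)n_{-1,1}n_{1,3}\\ (p-1)(-p^{\frac{m+1}2}-p^{\frac{m+3}2}) & 2(p^m-1)n_{-1,1}n_{-1,3}\\ 0 & n_0^2+2n_1n_{-1}+(p^m-1)(n_0^*)^2+2(p^m-1)(n_{1,1}n_{-1,1}+n_{1,3}n_{-1,3}) \end{array}$$ No value outside the table is taken. For $p\ne 3$ the $17$ listed values are pairwise distinct; where listed values coincide (which happens only for $p=3$, where $p^{\frac{m+3}2}-p^{\frac{m+1}2}=2p^{\frac{m+1}2}$), the frequencies of the rows with the same value are to be added. -/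

import Mathlib

noncomputable section

namespace FiveZeros

/-- `D(u,v,w) = ∑_{y ∈ 𝔽_p^*} ∑_{x ∈ F} ζ ^ (y * Tr(u x² + v x^(p^k+1) + w x^(p^(2k)+1)))`, where `F` is a
finite extension of `𝔽_p`, `Tr` is the trace from `F` to `𝔽_p`, and `ζ` is a `p`-th root of unity. The
exponent, an element of `𝔽_p`, is represented by its least natural-number representative. -/
def D (p k : ℕ) [Fact p.Prime] (F : Type*) [Field F] [Fintype F] [Algebra (ZMod p) F]
    (ζ : ℂ) (u v w : F) : ℂ :=
  ∑ y : (ZMod p)ˣ, ∑ x : F,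
    ζ ^ ((y : ZMod p) * Algebra.trace (ZMod p) F
      (u * x ^ 2 + v * x ^ (p ^ k + 1) + w * x ^ (p ^ (2 * k) + 1))).val

/-- `S(a₁,a₂,b₁,b₂,c) = D(a₁+a₂, b₁+b₂, c) + D(a₁-a₂, b₁-b₂, c)`. -/
def S (p k : ℕ) [Fact p.Prime] (F : Type*) [Field F] [Fintype F] [Algebra (ZMod p) F]
    (ζ : ℂ) (a₁ a₂ b₁ b₂ c : F) : ℂ :=
  D p k F ζ (a₁ + a₂) (b₁ + b₂) c + D p k F ζ (a₁ - a₂) (b₁ - b₂) c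

/-- `T(a₁,a₂,b₁,b₂,c) = D(a₁+a₂, b₁+b₂, c) + D(a₁-a₂, -(b₁-b₂), c)`. -/
def T (p k : ℕ) [Fact p.Prime] (F : Type*) [Field F] [Fintype F] [Algebra (ZMod p) F]
    (ζ : ℂ) (a₁ a₂ b₁ b₂ c : F) : ℂ :=
  D p k F ζ (a₁ + a₂) (b₁ + b₂) c + D p k F ζ (a₁ - a₂) (-(b₁ - b₂)) c

/-- `n₀ = (p^m - 1)(p^m - p^(m-1) + 1)`. -/
def n0 (p m : ℕ) : ℚ := ((p : ℚ) ^ m - 1) * ((p : ℚ) ^ m - (p : ℚ) ^ (m - 1) + 1)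

/-- `n_ε = (p^m - 1)(p^(m-1) + ε p^((m-1)/2)) / 2`, for `ε = ±1`. -/
def nE (p m : ℕ) (ε : ℤ) : ℚ :=
  ((p : ℚ) ^ m - 1) * ((p : ℚ) ^ (m - 1) + ε * (p : ℚ) ^ ((m - 1) / 2)) / 2

/-- `n₀^* = p^(2m) - p^(2m-1) + p^(2m-4) - p^(m-3)`. -/
def n0s (p m : ℕ) : ℚ :=
  (p : ℚ) ^ (2 * m) - (p : ℚ) ^ (2 * m - 1) + (p : ℚ) ^ (2 * m - 4) - (p : ℚ) ^ (m - 3)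

/-- `n_{ε,1} = (p^(m+2) - p^m - p^(m-1) + 1)(p^(m-1) + ε p^((m-1)/2)) / (2(p²-1))`, for `ε = ±1`. -/
def nE1 (p m : ℕ) (ε : ℤ) : ℚ :=
  ((p : ℚ) ^ (m + 2) - (p : ℚ) ^ m - (p : ℚ) ^ (m - 1) + 1) *
    ((p : ℚ) ^ (m - 1) + ε * (p : ℚ) ^ ((m - 1) / 2)) / (2 * ((p : ℚ) ^ 2 - 1))

/-- `n_{ε,3} = (p^(m-1) - 1)(p^(m-3) + ε p^((m-3)/2)) / (2(p²-1))`, for `ε = ±1`. -/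
def nE3 (p m : ℕ) (ε : ℤ) : ℚ :=
  ((p : ℚ) ^ (m - 1) - 1) * ((p : ℚ) ^ (m - 3) + ε * (p : ℚ) ^ ((m - 3) / 2)) /
    (2 * ((p : ℚ) ^ 2 - 1))

/-- The table of values (first component) and frequencies (second component). -/
def table (p m : ℕ) : List (ℤ × ℚ) :=
  let q : ℤ := (p : ℤ) ^ m
  let A : ℤ := (p : ℤ) ^ ((m + 1) / 2)
  let B : ℤ := (p : ℤ) ^ ((m + 3) / 2)
  let r : ℤ := (p : ℤ) - 1
  let N : ℚ := (p : ℚ) ^ m - 1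
  [ (2 * r * q, 1),
    (r * q, 2 * n0 p m),
    (r * (q - A), 2 * nE p m (-1)),
    (r * (q + A), 2 * nE p m 1),
    (r * A, 2 * n0 p m * nE p m 1 + 2 * N * n0s p m * nE1 p m 1),
    (r * B, 2 * N * n0s p m * nE3 p m 1),
    (2 * r * A, nE p m 1 ^ 2 + N * nE1 p m 1 ^ 2),
    (2 * r * B, N * nE3 p m 1 ^ 2),
    (-(r * A), 2 * n0 p m * nE p m (-1) + 2 * N * n0s p m * nE1 p m (-1)),
    (-(r * B), 2 * N * n0s p m * nE3 p m (-1)),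
    (-(2 * r * A), nE p m (-1) ^ 2 + N * nE1 p m (-1) ^ 2),
    (-(2 * r * B), N * nE3 p m (-1) ^ 2),
    (r * (A + B), 2 * N * nE1 p m 1 * nE3 p m 1),
    (r * (A - B), 2 * N * nE1 p m 1 * nE3 p m (-1)),
    (r * (-A + B), 2 * N * nE1 p m (-1) * nE3 p m 1),
    (r * (-A - B), 2 * N * nE1 p m (-1) * nE3 p m (-1)),
    (0, n0 p m ^ 2 + 2 * nE p m 1 * nE p m (-1) + N * n0s p m ^ 2
      + 2 * N * (nE1 p m 1 * nE1 p m (-1) + nE3 p m 1 * nE3 p m (-1))) ]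

/-- The function `f` on the finite type `X` has the value distribution given by the list `t` of pairs
(value, frequency): every complex number `z` is attained exactly as often as the rows of `t` with value `z`
say, their frequencies being added up; in particular, `f` takes no value that is not listed. -/
def HasValueDistribution {X : Type*} (f : X → ℂ) (t : List (ℤ × ℚ)) : Prop :=
  ∀ z : ℂ, (Nat.card {x : X // f x = z} : ℚ) =
    (t.map fun row => if (row.1 : ℂ) = z then row.2 else 0).sum

end FiveZeros

end

/-! Write `σ` for the `k`-th power of Frobenius; since `gcd(m,k) = 1` it generates the Galois group
of `F` over `𝔽_p`. `D(u,v,w)` sums the exponential sums of the nonzero multiples of the quadratic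
form `Q(x) = Tr(u x² + v x σx + w x σ²x)`. Diagonalizing `Q` and evaluating Gauss sums gives `D = 0`
if the rank is odd and `D² = (p-1)² p^m |rad Q|` if it is even. The radical is killed by a nonzero
`σ`-polynomial of degree at most 4, or at most 2 if `w = 0` and `(u,v) ≠ 0`, so its dimension obeys
the same bound (`finrank_lt_of_linearized`). As `m` is odd, only dimensions 1 and 3 give nonzero
values, and five possible values remain for `w ≠ 0`.

Their frequencies come from power moments. The relations `D³ = (p-1)² p^m D |rad Q|` and `D⁴ =
(p-1)² p^m D² |rad Q|`, where `p^m |rad Q|` is the character sum of the polar form, turn moments up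
to the fourth into counts of solutions of equations in `x`, `σx`, `σ²x`. These equations say exactly
that a symmetric tensor `y₁ x₁⊗x₁ + y₂ x₂⊗x₂ + t⊗a + a⊗t` over `𝔽_p` vanishes
(`tensorVanishes_iff`), which is elementary to count. For moments up to the third two of the
equations already force vanishing, so `w` can be fixed. The fourth needs the third equation, hence a
sum over `w`. Scaling `x ↦ a x` shows that all `w ≠ 0` contribute equally, and the `w = 0` term is
known from its own first moments (`sum_D_pow_four_eq`).

Finally `(a₁±a₂, b₁±b₂)` are two independent pairs because 2 is invertible, so for each `c` the
distribution of `S` or `T` is the convolution of that of `D(·,·,c)` with itself. -/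

noncomputable section

namespace FiveZeros

/-! ### Exponential sums of quadratic forms over `𝔽_p`. -/

section GaussSums

variable {p : ℕ} [Fact p.Prime]

/-- The quadratic exponential sum in one variable is a Gauss sum. -/
theorem sum_addChar_mul_sq (hp : p ≠ 2) {e : AddChar (ZMod p) ℂ} (he : e.IsPrimitive)
    {c : ZMod p} (hc : c ≠ 0) :
    ∑ x : ZMod p, e (c * x ^ 2) = (quadraticChar (ZMod p) c : ℂ) *
      gaussSum ((quadraticChar (ZMod p)).ringHomComp (Int.castRingHom ℂ)) e := by
  classical
  have hchar : ringChar (ZMod p) ≠ 2 := by rwa [ZMod.ringChar_zmod_n]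
  have h1 : ∑ x : ZMod p, e (c * x ^ 2) =
      ∑ a : ZMod p, ((quadraticChar (ZMod p) a : ℂ) + 1) * e (c * a) := by
    rw [← Finset.sum_fiberwise (s := Finset.univ) (g := fun x : ZMod p => x ^ 2)]
    refine Finset.sum_congr rfl fun a _ => ?_
    have h2 := quadraticChar_card_sqrts hchar a
    have h3 : ({x : ZMod p | x ^ 2 = a}.toFinset) = Finset.univ.filter (fun x => x ^ 2 = a) := by
      ext x; simp
    rw [h3] at h2
    rw [Finset.sum_congr rfl (g := fun _ => e (c * a))
      (fun x hx => by rw [(Finset.mem_filter.mp hx).2]), Finset.sum_const, nsmul_eq_mul]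
    congr 1
    exact_mod_cast congrArg (Int.cast : ℤ → ℂ) h2
  have h4 : ∑ a : ZMod p, e (c * a) = 0 := by
    have := AddChar.sum_mulShift c he
    rw [if_neg hc] at this
    simpa [mul_comm] using this
  have h5 := gaussSum_mulShift ((quadraticChar (ZMod p)).ringHomComp (Int.castRingHom ℂ)) e
    (Units.mk0 c hc)
  rw [h1]
  simp only [add_mul, one_mul, Finset.sum_add_distrib, h4, add_zero]
  rw [← h5]
  simp only [gaussSum, AddChar.mulShift_apply, Units.val_mk0, MulChar.ringHomComp_apply,
    Int.coe_castRingHom]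
  rw [← mul_assoc, ← Int.cast_mul, ← sq, quadraticChar_sq_one hc, Int.cast_one, one_mul]

theorem gaussSum_quadraticChar_sq (hp : p ≠ 2) {e : AddChar (ZMod p) ℂ} (he : e.IsPrimitive) :
    gaussSum ((quadraticChar (ZMod p)).ringHomComp (Int.castRingHom ℂ)) e ^ 2 =
      (quadraticChar (ZMod p) (-1) : ℂ) * p := by
  have hchar : ringChar (ZMod p) ≠ 2 := by rwa [ZMod.ringChar_zmod_n]
  rw [gaussSum_sq _ _ he]
  · simp
  · intro h
    apply quadraticChar_ne_one hchar
    ext a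
    have := congrArg (fun χ : MulChar (ZMod p) ℂ => χ a) h
    simp only [MulChar.ringHomComp_apply, MulChar.one_apply a.isUnit, Int.coe_castRingHom] at this
    rw [MulChar.one_apply a.isUnit]
    exact_mod_cast this
  · exact (quadraticChar_isQuadratic (ZMod p)).comp _

theorem addChar_sum {R ι : Type*} [AddCommMonoid R] (e : AddChar R ℂ) (s : Finset ι) (f : ι → R) :
    e (∑ i ∈ s, f i) = ∏ i ∈ s, e (f i) := by
  classical
  induction s using Finset.induction_on with
  | empty => simp
  | insert a s ha ih => rw [Finset.sum_insert ha, Finset.prod_insert ha, e.map_add_eq_mul, ih]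

variable {V : Type*} [AddCommGroup V] [Module (ZMod p) V] [Fintype V]

/-- The sum of the exponential sums of the nonzero multiples of a quadratic form. -/
def scaledExpSum (e : AddChar (ZMod p) ℂ) (Q : QuadraticForm (ZMod p) V) : ℂ :=
  ∑ y : (ZMod p)ˣ, ∑ x : V, e (y * Q x)

theorem quadraticChar_units_sq (y : (ZMod p)ˣ) : (quadraticChar (ZMod p) (y : ZMod p)) ^ 2 = 1 :=
  quadraticChar_sq_one y.ne_zero

/-- In a diagonalization each zero coefficient contributes a factor `p` and each nonzero one, `w i`,
the Gauss sum times `η(y) η(w i)`, with `η` the quadratic character. Thus `r` is the rank and only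
`η(y) ^ r` depends on `y`. -/
theorem scaledExpSum_eq (hp : p ≠ 2) {e : AddChar (ZMod p) ℂ} (he : e.IsPrimitive)
    (Q : QuadraticForm (ZMod p) V) :
    ∃ (r : ℕ) (δ : ℤ), δ ^ 2 = 1 ∧
      r + Module.finrank (ZMod p) Q.radical = Module.finrank (ZMod p) V ∧
      scaledExpSum e Q = (∑ y : (ZMod p)ˣ, (quadraticChar (ZMod p) (y : ZMod p) : ℂ) ^ r) *
        (δ * (p : ℂ) ^ Module.finrank (ZMod p) Q.radical *
        gaussSum ((quadraticChar (ZMod p)).ringHomComp (Int.castRingHom ℂ)) e ^ r) := by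
  classical
  have h2 : (2 : ZMod p) ≠ 0 := by
    have : Fact (2 < p) := ⟨lt_of_le_of_ne (Fact.out : p.Prime).two_le hp.symm⟩
    exact Ring.two_ne_zero (by rwa [ZMod.ringChar_zmod_n])
  have : NeZero (2 : ZMod p) := ⟨h2⟩
  let _ : Invertible (2 : ZMod p) := invertibleOfNonzero h2
  obtain ⟨w, hw⟩ := Q.equivalent_weightedSumSquares
  have hrad := QuadraticForm.finrank_radical_of_equiv_weightedSumSquares hw
  obtain ⟨f⟩ := hw
  set G := gaussSum ((quadraticChar (ZMod p)).ringHomComp (Int.castRingHom ℂ)) e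
  set Z : Finset (Fin (Module.finrank (ZMod p) V)) := Finset.univ.filter (fun i => w i = 0)
  have hZ : Module.finrank (ZMod p) Q.radical = Z.card := by
    rw [hrad, Set.ncard_eq_toFinset_card']
    congr 1
    ext i; simp [Z]
  set N : Finset (Fin (Module.finrank (ZMod p) V)) := Finset.univ.filter (fun i => ¬ w i = 0)
  refine ⟨N.card, ∏ i ∈ N, quadraticChar (ZMod p) (w i), ?_, ?_, ?_⟩
  · rw [← Finset.prod_pow]
    refine Finset.prod_eq_one fun i hi => quadraticChar_sq_one ?_
    exact (Finset.mem_filter.mp hi).2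
  · rw [hZ, add_comm, Finset.card_filter_add_card_filter_not]
    simp
  · rw [hZ, scaledExpSum, Finset.sum_mul]
    refine Finset.sum_congr rfl fun y _ => ?_
    have h3 : ∑ x : V, e (y * Q x) =
        ∑ x : Fin (Module.finrank (ZMod p) V) → ZMod p, e (y * QuadraticMap.weightedSumSquares (ZMod p) w x) := by
      refine Fintype.sum_equiv f.toLinearEquiv.toEquiv _ _ fun x => ?_
      have := f.map_app x
      rw [← this]; rfl
    have h4 : ∀ x : Fin (Module.finrank (ZMod p) V) → ZMod p, e (y * QuadraticMap.weightedSumSquares (ZMod p) w x) =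
        ∏ i, e (y * w i * x i ^ 2) := by
      intro x
      rw [QuadraticMap.weightedSumSquares_apply, Finset.mul_sum, addChar_sum]
      refine Finset.prod_congr rfl fun i _ => ?_
      rw [smul_eq_mul, sq, mul_assoc]
    rw [h3, Finset.sum_congr rfl (fun x _ => h4 x),
      ← Fintype.prod_sum (fun i a => e (y * w i * a ^ 2)),
      ← Finset.prod_filter_mul_prod_filter_not Finset.univ (fun i => w i = 0)]
    have h5 : ∏ i ∈ Z, ∑ a : ZMod p, e (y * w i * a ^ 2) = (p : ℂ) ^ Z.card := by
      refine Finset.prod_eq_pow_card fun i hi => ?_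
      simp [(Finset.mem_filter.mp hi).2, ZMod.card]
    have h6 : ∏ i ∈ N, ∑ a : ZMod p, e (y * w i * a ^ 2) =
        ∏ i ∈ N, ((quadraticChar (ZMod p) (y : ZMod p) : ℂ) *
          ((quadraticChar (ZMod p) (w i) : ℤ) : ℂ) * G) := by
      refine Finset.prod_congr rfl fun i hi => ?_
      rw [sum_addChar_mul_sq hp he (mul_ne_zero y.ne_zero (Finset.mem_filter.mp hi).2), map_mul,
        Int.cast_mul]
    rw [h5, h6, Finset.prod_mul_distrib, Finset.prod_mul_distrib, Finset.prod_const,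
      Finset.prod_const, Int.cast_prod]
    ring

/-- For odd rank, `η(y) ^ r = η(y)`, and the nontrivial character `η` sums to zero. -/
theorem scaledExpSum_of_odd (hp : p ≠ 2) {e : AddChar (ZMod p) ℂ} (he : e.IsPrimitive)
    (Q : QuadraticForm (ZMod p) V)
    (h : ¬ Even (Module.finrank (ZMod p) V + Module.finrank (ZMod p) Q.radical)) :
    scaledExpSum e Q = 0 := by
  classical
  obtain ⟨r, δ, -, hr, hD⟩ := scaledExpSum_eq hp he Q
  have hodd : Odd r := by
    rw [← Nat.not_even_iff_odd]
    intro hev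
    apply h
    rw [← hr, add_assoc]
    exact hev.add (Even.add_self _)
  have hchar : ringChar (ZMod p) ≠ 2 := by rwa [ZMod.ringChar_zmod_n]
  rw [hD]
  convert zero_mul _
  obtain ⟨s, rfl⟩ := hodd
  have h1 : ∀ y : (ZMod p)ˣ, (quadraticChar (ZMod p) (y : ZMod p) : ℂ) ^ (2 * s + 1) =
      (quadraticChar (ZMod p) (y : ZMod p) : ℂ) := by
    intro y
    rw [pow_succ, pow_mul, ← Int.cast_pow, quadraticChar_units_sq]
    simp
  rw [Finset.sum_congr rfl fun y _ => h1 y]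
  have h2 := quadraticChar_sum_zero hchar
  rw [← Int.cast_sum]
  norm_cast
  rw [← h2, Fintype.sum_eq_add_sum_subtype_ne _ (0 : ZMod p), MulChar.map_zero, zero_add]
  exact Fintype.sum_equiv unitsEquivNeZero _ _ fun y => rfl

/-- For even rank `r` the factors `η(y) ^ r` are 1. Squaring removes the sign `δ`, and `G² = η(-1)
p` turns `G ^ (2r)` into `p ^ r`. -/
theorem scaledExpSum_sq_of_even (hp : p ≠ 2) {e : AddChar (ZMod p) ℂ} (he : e.IsPrimitive)
    (Q : QuadraticForm (ZMod p) V)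
    (h : Even (Module.finrank (ZMod p) V + Module.finrank (ZMod p) Q.radical)) :
    scaledExpSum e Q ^ 2 = ((p : ℂ) - 1) ^ 2 *
      (p : ℂ) ^ (Module.finrank (ZMod p) V + Module.finrank (ZMod p) Q.radical) := by
  classical
  obtain ⟨r, δ, hδ, hr, hD⟩ := scaledExpSum_eq hp he Q
  have hev : Even r := by
    rw [← hr, add_assoc] at h
    exact (Nat.even_add.mp h).mpr (Even.add_self _)
  obtain ⟨s, rfl⟩ := hev
  have h1 : ∀ y : (ZMod p)ˣ, (quadraticChar (ZMod p) (y : ZMod p) : ℂ) ^ (s + s) = 1 := by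
    intro y
    rw [← two_mul, pow_mul, ← Int.cast_pow, quadraticChar_units_sq]
    simp
  have h2 : (quadraticChar (ZMod p) (-1) : ℂ) ^ (s + s) = 1 := by
    simpa using h1 (-1)
  have hp1 : ((p - 1 : ℕ) : ℂ) = (p : ℂ) - 1 := by
    rw [Nat.cast_sub (Fact.out : p.Prime).one_le]; simp
  have hδ' : (δ : ℂ) ^ 2 = 1 := by exact_mod_cast hδ
  rw [hD, Finset.sum_congr rfl fun y _ => h1 y, Finset.sum_const, Finset.card_univ,
    ZMod.card_units, nsmul_eq_mul, mul_one, hp1, mul_pow, mul_pow, mul_pow, hδ', ← pow_mul (gaussSum _ _),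
    mul_comm (s + s) 2, pow_mul (gaussSum _ _), gaussSum_quadraticChar_sq hp he, mul_pow, h2, ← hr]
  ring

end GaussSums

/-! ### Linear relations among conjugates of a vector. -/

section Semilinear

/-- A linear relation between the entries of the first `card ι` conjugates of a vector holds for all of
its conjugates. -/
theorem sum_mul_iterate_eq_zero {F ι : Type*} [Field F] [Fintype ι] (σ : F →+* F) (x β : ι → F)
    (h : ∀ j < Fintype.card ι, ∑ i, β i * σ^[j] (x i) = 0) (j : ℕ) :
    ∑ i, β i * σ^[j] (x i) = 0 := by
  classical
  set X : Fin (Fintype.card ι + 1) → ι → F := fun j i => σ^[j] (x i) with hX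
  have hdep : ¬ LinearIndependent F X := by
    intro hli
    have := hli.fintype_card_le_finrank
    simp at this
  obtain ⟨c, hc, i₀, hi₀⟩ := Fintype.not_linearIndependent_iff.mp hdep
  -- The first `card ι + 1` conjugates are linearly dependent. The last nonzero coefficient `c l`,
  -- with `l ≤ card ι`, expresses the `l`-th conjugate by earlier ones; applying powers of `σ` gives
  -- a recursion for all later conjugates.
  set S : Finset (Fin (Fintype.card ι + 1)) := Finset.univ.filter fun j => c j ≠ 0
  have hS : S.Nonempty := ⟨i₀, by simp [S, hi₀]⟩
  set l := S.max' hS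
  have hl : c l ≠ 0 := (Finset.mem_filter.mp (S.max'_mem hS)).2
  have hgt : ∀ j, l < j → c j = 0 := by
    intro j hj
    by_contra hcj
    exact absurd (S.le_max' j (by simp [S, hcj])) (not_le.mpr hj)
  have hrel : ∀ (n : ℕ) (i : ι), ∑ j, σ^[n] (c j) * σ^[n + j] (x i) = 0 := by
    intro n i
    have h1 := congrFun hc i
    simp only [Finset.sum_apply, Pi.smul_apply, smul_eq_mul, Pi.zero_apply, hX] at h1
    have h2 := congrArg (σ ^ n) h1
    simp only [map_sum, map_mul, map_zero, RingHom.coe_pow] at h2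
    simpa only [Function.iterate_add_apply] using h2
  induction j using Nat.strong_induction_on with
  | _ N ih =>
    by_cases hN : N < Fintype.card ι
    · exact h N hN
    · obtain ⟨n, rfl⟩ : ∃ n, N = n + l :=
        ⟨N - l, (Nat.sub_add_cancel ((Nat.lt_succ_iff.mp l.2).trans (not_lt.mp hN))).symm⟩
      have h3 : ∑ j : Fin (Fintype.card ι + 1), σ^[n] (c j) * ∑ i, β i * σ^[n + j] (x i) = 0 := by
        simp only [Finset.mul_sum]
        rw [Finset.sum_comm]
        refine Finset.sum_eq_zero fun i _ => ?_
        have := congrArg (β i * ·) (hrel n i)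
        simp only [Finset.mul_sum, mul_zero] at this
        rw [← this]
        exact Finset.sum_congr rfl fun j _ => by ring
      rw [Finset.sum_eq_single l] at h3
      · refine (mul_eq_zero.mp h3).resolve_left ?_
        have : σ^[n] (c l) = (σ ^ n) (c l) := by rw [RingHom.coe_pow]
        rw [this]
        exact (map_ne_zero (σ ^ n)).mpr hl
      · intro j _ hj
        rcases lt_or_gt_of_ne hj with hlt | hlt
        · rw [ih (n + j) (by simpa using hlt), mul_zero]
        · rw [hgt j hlt]
          have : σ^[n] 0 = (σ ^ n) 0 := by rw [RingHom.coe_pow]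
          rw [this, map_zero, zero_mul]
      · simp

end Semilinear

/-! ### The Frobenius power as a Galois generator, trace duality, and kernels of linearized
polynomials. -/

section Frobenius

variable (p k : ℕ) [Fact p.Prime] (F : Type*) [Field F] [Fintype F] [Algebra (ZMod p) F]

/-- The `k`-th power of the Frobenius automorphism. -/
def frobPow : F ≃ₐ[ZMod p] F := FiniteField.frobeniusAlgEquivOfAlgebraic (ZMod p) F ^ k

variable {p k F}

theorem frobPow_apply (x : F) : frobPow p k F x = x ^ p ^ k := by
  rw [frobPow, AlgEquiv.coe_pow, FiniteField.coe_frobeniusAlgEquivOfAlgebraic_iterate, ZMod.card]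

theorem frobPow_frobPow (x : F) : frobPow p k F (frobPow p k F x) = x ^ p ^ (2 * k) := by
  rw [frobPow_apply, frobPow_apply, ← pow_mul, ← pow_add, two_mul]

/-- Frobenius has order `[F : 𝔽_p]`, and `k` is prime to that order, so the `k`-th power still
generates the Galois group. -/
theorem exists_frobPow_pow_eq (hk : Nat.Coprime k (Module.finrank (ZMod p) F)) (τ : F ≃ₐ[ZMod p] F) :
    ∃ j : ℕ, τ = frobPow p k F ^ j := by
  rw [← FiniteField.orderOf_frobeniusAlgEquivOfAlgebraic] at hk
  obtain ⟨n, hn⟩ := exists_pow_eq_self_of_coprime hk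
  obtain ⟨l, hl⟩ := (FiniteField.bijective_frobeniusAlgEquivOfAlgebraic_pow (ZMod p) F).2 τ
  refine ⟨n * l, ?_⟩
  rw [frobPow, pow_mul, hn]
  exact hl.symm

theorem mem_range_algebraMap_of_frobPow_eq (hk : Nat.Coprime k (Module.finrank (ZMod p) F)) {a : F}
    (ha : frobPow p k F a = a) : ∃ c : ZMod p, algebraMap (ZMod p) F c = a := by
  have h := (IsGalois.mem_range_algebraMap_iff_fixed (F := ZMod p) (E := F) a).mpr fun τ => by
    obtain ⟨j, rfl⟩ := exists_frobPow_pow_eq hk τ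
    rw [AlgEquiv.coe_pow]
    exact Function.iterate_fixed ha j
  exact h

theorem exists_trace_mul_eq (f : F →ₗ[ZMod p] ZMod p) :
    -- Nondegeneracy of the trace form identifies `F` with its dual.
    ∃ a : F, ∀ x, f x = Algebra.trace (ZMod p) F (a * x) := by
  have hnd := traceForm_nondegenerate (ZMod p) F
  refine ⟨(LinearMap.BilinForm.toDual _ hnd).symm f, fun x => ?_⟩
  rw [← Algebra.traceForm_apply, LinearMap.BilinForm.apply_toDual_symm_apply]

theorem eq_zero_of_trace_mul_eq_zero {b : F} (h : ∀ a : F, Algebra.trace (ZMod p) F (a * b) = 0) :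
    b = 0 := by
  have hnd := traceForm_nondegenerate (ZMod p) F
  exact hnd.2 b h

theorem trace_frobPow (x : F) :
    Algebra.trace (ZMod p) F (frobPow p k F x) = Algebra.trace (ZMod p) F x :=
  (Algebra.trace_eq_of_algEquiv (frobPow p k F) x)

/-- If `card ι` consecutive `frobPow`-conjugates of `x` are orthogonal to `β`, then `∑ β i ⊗ x i = 0`. -/
theorem sum_mul_functional_eq_zero (hk : Nat.Coprime k (Module.finrank (ZMod p) F)) {ι : Type*}
    [Fintype ι] (x β : ι → F) (ρ : F ≃ₐ[ZMod p] F)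
    (h : ∀ j < Fintype.card ι, ∑ i, β i * (frobPow p k F)^[j] (ρ (x i)) = 0)
    (f : F →ₗ[ZMod p] ZMod p) : ∑ i, β i * algebraMap (ZMod p) F (f (x i)) = 0 := by
  -- Every `τ` is `σ^j ρ` for some `j`; choosing `ρ` to be a negative power of `σ` lets the window
  -- of given relations start at a negative exponent. Expanding `f x = Tr(a x)` over all
  -- automorphisms then gives the claim.
  have hall : ∀ τ : F ≃ₐ[ZMod p] F, ∑ i, β i * τ (x i) = 0 := by
    intro τ
    obtain ⟨j, hj⟩ := exists_frobPow_pow_eq hk (τ * ρ⁻¹)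
    have h1 := sum_mul_iterate_eq_zero
      ((frobPow p k F : F ≃ₐ[ZMod p] F) : F →+* F) (fun i => ρ (x i)) β h j
    have h2 : ∀ y : F, (frobPow p k F)^[j] (ρ y) = τ y := by
      intro y
      rw [← AlgEquiv.coe_pow, ← hj, AlgEquiv.mul_apply]
      simp [AlgEquiv.aut_inv]
    rw [← h1]
    exact Finset.sum_congr rfl fun i _ => congrArg _ (h2 (x i)).symm
  obtain ⟨a, ha⟩ := exists_trace_mul_eq f
  simp only [ha, trace_eq_sum_automorphisms, Finset.mul_sum]
  rw [Finset.sum_comm]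
  refine Finset.sum_eq_zero fun τ _ => ?_
  have := congrArg (τ a * ·) (hall τ)
  simp only [Finset.mul_sum, mul_zero] at this
  rw [← this]
  exact Finset.sum_congr rfl fun i _ => by rw [map_mul]; ring

/-- A nonzero `frobPow`-polynomial of degree less than `r` has a kernel of dimension less than `r`. -/
theorem finrank_lt_of_linearized (hk : Nat.Coprime k (Module.finrank (ZMod p) F)) {r : ℕ}
    (c : Fin r → F) (hc : c ≠ 0) (W : Submodule (ZMod p) F)
    (hW : ∀ t ∈ W, ∑ j, c j * (frobPow p k F)^[j] t = 0) :
    Module.finrank (ZMod p) W < r := by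
  classical
  by_contra! hr
  obtain ⟨z, hz⟩ := exists_linearIndependent_of_le_finrank hr
  have hz' : LinearIndependent (ZMod p) (fun i => (z i : F)) :=
    hz.map' W.subtype (Submodule.ker_subtype W)
  -- The Moore matrix of independent kernel elements `z i`: the coefficients `c` are a left null
  -- vector, so there is a right null vector `β`. Functionals dual to the `z i` force each `β i` to
  -- vanish.
  let M : Matrix (Fin r) (Fin r) F := fun j i => (frobPow p k F)^[j] (z i : F)
  have hdet : M.det = 0 := by
    rw [← Matrix.exists_vecMul_eq_zero_iff]
    refine ⟨c, hc, ?_⟩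
    ext i
    exact hW _ (z i).2
  obtain ⟨β, hβ, hMβ⟩ := Matrix.exists_mulVec_eq_zero_iff.mpr hdet
  apply hβ
  ext i₀
  obtain ⟨f, hf⟩ := LinearMap.exists_extend
    ((Finsupp.lapply i₀ : (Fin r →₀ ZMod p) →ₗ[ZMod p] ZMod p) ∘ₗ hz'.repr)
  have hfz : ∀ i, f (z i : F) = if i = i₀ then 1 else 0 := by
    intro i
    have h1 := LinearMap.congr_fun hf ⟨z i, Submodule.subset_span (Set.mem_range_self i)⟩
    simp only [LinearMap.comp_apply, Submodule.subtype_apply,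
      Finsupp.lapply_apply] at h1
    rw [h1, hz'.repr_eq_single i ⟨z i, _⟩ rfl, Finsupp.single_apply]
  have h2 := sum_mul_functional_eq_zero hk (fun i => (z i : F)) β 1 (fun j hj => by
    rw [Fintype.card_fin] at hj
    have := congrFun hMβ ⟨j, hj⟩
    simp only [Matrix.mulVec, dotProduct, Pi.zero_apply] at this
    rw [← this]
    exact Finset.sum_congr rfl fun i _ => by simp [M, mul_comm]) f
  simpa [hfz] using h2

end Frobenius

/-! ### The quadratic form of `D(u,v,w)`, its radical, and the values of `D`. -/

section Forms

variable {p k : ℕ} [Fact p.Prime] {F : Type*} [Field F] [Fintype F] [Algebra (ZMod p) F]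

theorem finrank_eq_of_card {m : ℕ} (hF : Fintype.card F = p ^ m) :
    Module.finrank (ZMod p) F = m := by
  have h := Module.card_eq_pow_finrank (K := ZMod p) (V := F)
  rw [hF, ZMod.card] at h
  exact (Nat.pow_right_injective (Fact.out : p.Prime).two_le h).symm

theorem two_ne_zero_zmod (hp : p ≠ 2) : (2 : ZMod p) ≠ 0 :=
  Ring.two_ne_zero (by rwa [ZMod.ringChar_zmod_n])

variable (F) in
omit [Fintype F] in
theorem two_ne_zero_of_ne (hp : p ≠ 2) : (2 : F) ≠ 0 := by
  rw [← map_ofNat (algebraMap (ZMod p) F) 2]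
  exact (map_ne_zero _).mpr (two_ne_zero_zmod hp)

variable (p k F) in
/-- The bilinear form `(x, y) ↦ Tr(u x y + v x y^(p^k) + w x y^(p^(2k)))`. -/
def biForm (u v w : F) : LinearMap.BilinForm (ZMod p) F :=
  LinearMap.mk₂ (ZMod p)
    (fun x y => Algebra.trace (ZMod p) F
      (u * (x * y) + v * (x * frobPow p k F y) + w * (x * frobPow p k F (frobPow p k F y))))
    (fun x x' y => by rw [← map_add]; congr 1; ring)
    (fun c x y => by rw [← map_smul]; congr 1; simp only [Algebra.smul_def]; ring)
    (fun x y y' => by rw [← map_add]; congr 1; simp only [map_add]; ring)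
    (fun c x y => by
      rw [← map_smul]; congr 1; simp only [Algebra.smul_def, map_mul, AlgEquiv.commutes]; ring)

variable (p k F) in
/-- The quadratic form `x ↦ Tr(u x² + v x^(p^k+1) + w x^(p^(2k)+1))`. -/
def quadForm (u v w : F) : QuadraticForm (ZMod p) F :=
  (biForm p k F u v w).toQuadraticMap

theorem quadForm_apply (u v w x : F) : quadForm p k F u v w x = Algebra.trace (ZMod p) F
    (u * (x * x) + v * (x * frobPow p k F x) + w * (x * frobPow p k F (frobPow p k F x))) := rfl

theorem D_eq_scaledExpSum {ζ : ℂ} (hζ : ζ ^ p = 1) (u v w : F) :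
    D p k F ζ u v w = scaledExpSum (AddChar.zmodChar p hζ) (quadForm p k F u v w) := by
  unfold D scaledExpSum
  refine Finset.sum_congr rfl fun y _ => Finset.sum_congr rfl fun x _ => ?_
  rw [AddChar.zmodChar_apply, quadForm_apply, frobPow_frobPow, frobPow_apply]
  congr 6 <;> ring

variable (p k F) in
/-- The polarization of `u x² + v x^(p^k+1) + w x^(p^(2k)+1)`. -/
def polarPoly (u v w a t : F) : F :=
  u * (2 * (a * t)) + v * (a * frobPow p k F t + t * frobPow p k F a) +
    w * (a * frobPow p k F (frobPow p k F t) + t * frobPow p k F (frobPow p k F a))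

theorem mem_radical_quadForm (hp : p ≠ 2) {u v w t : F} :
    t ∈ (quadForm p k F u v w).radical ↔
      ∀ a, Algebra.trace (ZMod p) F (polarPoly p k F u v w a t) = 0 := by
  let _ : Invertible (2 : ZMod p) := invertibleOfNonzero (two_ne_zero_zmod hp)
  rw [QuadraticMap.radical_eq_ker_polarBilin, LinearMap.mem_ker, LinearMap.ext_iff]
  refine forall_congr' fun a => ?_
  rw [QuadraticMap.polarBilin_apply_apply, QuadraticMap.polar, quadForm_apply, quadForm_apply,
    quadForm_apply, ← map_sub, ← map_sub, LinearMap.zero_apply]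
  have : ∀ X Y : F, X = Y →
      (Algebra.trace (ZMod p) F X = 0 ↔ Algebra.trace (ZMod p) F Y = 0) := by
    rintro X _ rfl; rfl
  apply this
  simp only [map_add, polarPoly]
  ring

/-- Invariance of the trace under `σ` moves all conjugations from `a` onto the other factor, and
nondegeneracy makes that factor vanish. It is a `σ`-polynomial in `t`, with exponents from -2 to 2
before the shift. -/
theorem linearized_eq_zero (hp : p ≠ 2) {u v w t : F}
    (ht : t ∈ (quadForm p k F u v w).radical) :
    w * t + frobPow p k F v * frobPow p k F t +
      2 * frobPow p k F (frobPow p k F u) * frobPow p k F (frobPow p k F t) +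
      frobPow p k F (frobPow p k F v) * frobPow p k F (frobPow p k F (frobPow p k F t)) +
      frobPow p k F (frobPow p k F w) *
        frobPow p k F (frobPow p k F (frobPow p k F (frobPow p k F t))) = 0 := by
  rw [mem_radical_quadForm hp] at ht
  apply eq_zero_of_trace_mul_eq_zero (p := p)
  intro b
  set σ := frobPow p k F with hσ
  have htr : ∀ x, Algebra.trace (ZMod p) F (σ x) = Algebra.trace (ZMod p) F x := trace_frobPow
  -- Testing against `σ² a` instead of `a` shifts the exponents to the range 0 to 4.
  obtain ⟨a, rfl⟩ : ∃ a, σ (σ a) = b := ⟨σ.symm (σ.symm b), by simp⟩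
  rw [← ht a]
  simp only [polarPoly, ← hσ, mul_add, map_add]
  have e1 : Algebra.trace (ZMod p) F (u * (2 * (a * t))) =
      Algebra.trace (ZMod p) F (σ (σ a) * (2 * σ (σ u) * σ (σ t))) := by
    rw [← htr, ← htr]; congr 1; simp only [map_mul, map_ofNat]; ring
  have e2 : Algebra.trace (ZMod p) F (v * (a * σ t)) =
      Algebra.trace (ZMod p) F (σ (σ a) * (σ (σ v) * σ (σ (σ t)))) := by
    rw [← htr, ← htr]; congr 1; simp only [map_mul]; ring
  have e3 : Algebra.trace (ZMod p) F (v * (t * σ a)) =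
      Algebra.trace (ZMod p) F (σ (σ a) * (σ v * σ t)) := by
    rw [← htr]; congr 1; simp only [map_mul]; ring
  have e4 : Algebra.trace (ZMod p) F (w * (a * σ (σ t))) =
      Algebra.trace (ZMod p) F (σ (σ a) * (σ (σ w) * σ (σ (σ (σ t))))) := by
    rw [← htr, ← htr]; congr 1; simp only [map_mul]; ring
  have e5 : Algebra.trace (ZMod p) F (w * (t * σ (σ a))) =
      Algebra.trace (ZMod p) F (σ (σ a) * (w * t)) := by
    congr 1; ring
  rw [e1, e2, e3, e4, e5]
  ring

theorem finrank_radical_le_four (hp : p ≠ 2) (hk : Nat.Coprime k (Module.finrank (ZMod p) F))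
    {u v w : F} (hw : w ≠ 0) : Module.finrank (ZMod p) (quadForm p k F u v w).radical ≤ 4 := by
  refine Nat.lt_succ_iff.mp (finrank_lt_of_linearized hk
    ![w, frobPow p k F v, 2 * frobPow p k F (frobPow p k F u), frobPow p k F (frobPow p k F v),
      frobPow p k F (frobPow p k F w)] (fun h => hw (congrFun h 0)) _ fun t ht => ?_)
  have := linearized_eq_zero hp ht
  rw [← this]
  simp [Fin.sum_univ_five]

theorem finrank_radical_le_two (hp : p ≠ 2) (hk : Nat.Coprime k (Module.finrank (ZMod p) F))
    {u v : F} (huv : (u, v) ≠ 0) :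
    Module.finrank (ZMod p) (quadForm p k F u v 0).radical ≤ 2 := by
  refine Nat.lt_succ_iff.mp (finrank_lt_of_linearized hk
    ![v, 2 * frobPow p k F u, frobPow p k F v] (fun h => huv ?_) _ fun t ht => ?_)
  · have h0 : v = 0 := congrFun h 0
    have h1 : 2 * frobPow p k F u = 0 := congrFun h 1
    have h2 : u = 0 := by simpa [two_ne_zero_of_ne F hp] using h1
    simp [h0, h2]
  · have := linearized_eq_zero hp ht
    -- For `w = 0` the degree-4 relation has only exponents 1 to 3, so one `σ` can be cancelled,
    -- leaving degree 2.
    apply (frobPow p k F).injective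
    rw [map_zero, ← this]
    simp only [Fin.sum_univ_three, Fin.val_zero, Fin.val_one, Fin.val_two, Function.iterate_succ,
      Function.iterate_zero, Function.comp_apply, id, Matrix.cons_val, map_add, map_mul, map_ofNat,
      map_zero]
    ring

section Values

variable {m : ℕ} {ζ : ℂ}

theorem isPrimitive_zmodChar (hζ : IsPrimitiveRoot ζ p) :
    (AddChar.zmodChar p hζ.pow_eq_one).IsPrimitive :=
  AddChar.zmodChar_primitive_of_primitive_root p hζ

theorem D_eq_zero_of_finrank (hp : p ≠ 2) (hF : Fintype.card F = p ^ m) (hζ : IsPrimitiveRoot ζ p)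
    {u v w : F} (h : ¬ Even (m + Module.finrank (ZMod p) (quadForm p k F u v w).radical)) :
    D p k F ζ u v w = 0 := by
  rw [D_eq_scaledExpSum hζ.pow_eq_one]
  exact scaledExpSum_of_odd hp (isPrimitive_zmodChar hζ) _ (by rwa [finrank_eq_of_card hF])

theorem D_sq_of_finrank (hp : p ≠ 2) (hF : Fintype.card F = p ^ m) (hζ : IsPrimitiveRoot ζ p)
    {u v w : F} (h : Even (m + Module.finrank (ZMod p) (quadForm p k F u v w).radical)) :
    D p k F ζ u v w ^ 2 = ((p : ℂ) - 1) ^ 2 *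
      (p : ℂ) ^ (m + Module.finrank (ZMod p) (quadForm p k F u v w).radical) := by
  rw [D_eq_scaledExpSum hζ.pow_eq_one,
    scaledExpSum_sq_of_even hp (isPrimitive_zmodChar hζ) _ (by rwa [finrank_eq_of_card hF]),
    finrank_eq_of_card hF]

theorem card_radical (u v w : F) : Nat.card (quadForm p k F u v w).radical =
    p ^ Module.finrank (ZMod p) (quadForm p k F u v w).radical := by
  rw [Module.natCard_eq_pow_finrank (K := ZMod p), Nat.card_zmod]

theorem D_eq_zero_or_sq (hp : p ≠ 2) (hF : Fintype.card F = p ^ m) (hζ : IsPrimitiveRoot ζ p)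
    (u v w : F) : D p k F ζ u v w = 0 ∨
      D p k F ζ u v w ^ 2 =
        ((p : ℂ) - 1) ^ 2 * p ^ m * Nat.card (quadForm p k F u v w).radical := by
  by_cases h : Even (m + Module.finrank (ZMod p) (quadForm p k F u v w).radical)
  · right
    rw [D_sq_of_finrank hp hF hζ h, card_radical]
    push_cast
    ring
  · exact Or.inl (D_eq_zero_of_finrank hp hF hζ h)

/-- Multiplying by `D` removes the case distinction between `D = 0` and `D ≠ 0`. Two factors `D` are
traded for the size of the radical, a character sum bilinear in its two summation variables. -/
theorem D_pow_three (hp : p ≠ 2) (hF : Fintype.card F = p ^ m) (hζ : IsPrimitiveRoot ζ p)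
    (u v w : F) : D p k F ζ u v w ^ 3 = ((p : ℂ) - 1) ^ 2 * p ^ m *
      (D p k F ζ u v w * Nat.card (quadForm p k F u v w).radical) := by
  rcases D_eq_zero_or_sq (k := k) hp hF hζ u v w with h | h
  · rw [h]; ring
  · rw [pow_succ, h]; ring

theorem D_pow_four (hp : p ≠ 2) (hF : Fintype.card F = p ^ m) (hζ : IsPrimitiveRoot ζ p)
    (u v w : F) : D p k F ζ u v w ^ 4 = ((p : ℂ) - 1) ^ 2 * p ^ m *
      (D p k F ζ u v w ^ 2 * Nat.card (quadForm p k F u v w).radical) := by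
  rcases D_eq_zero_or_sq (k := k) hp hF hζ u v w with h | h
  · rw [h]; ring
  · rw [pow_succ, pow_succ, mul_assoc, ← sq, h]; ring

theorem D_of_finrank_one (hp : p ≠ 2) (hm : Odd m) (hF : Fintype.card F = p ^ m)
    (hζ : IsPrimitiveRoot ζ p) {u v w : F}
    (h : Module.finrank (ZMod p) (quadForm p k F u v w).radical = 1) :
    D p k F ζ u v w = ((p : ℂ) - 1) * p ^ ((m + 1) / 2) ∨
      D p k F ζ u v w = -(((p : ℂ) - 1) * p ^ ((m + 1) / 2)) := by
  rw [← sq_eq_sq_iff_eq_or_eq_neg, D_sq_of_finrank hp hF hζ (by rw [h]; exact hm.add_one), h,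
    mul_pow, ← pow_mul, Nat.div_mul_cancel hm.add_one.two_dvd]

theorem D_of_finrank_three (hp : p ≠ 2) (hm : Odd m) (hF : Fintype.card F = p ^ m)
    (hζ : IsPrimitiveRoot ζ p) {u v w : F}
    (h : Module.finrank (ZMod p) (quadForm p k F u v w).radical = 3) :
    D p k F ζ u v w = ((p : ℂ) - 1) * p ^ ((m + 3) / 2) ∨
      D p k F ζ u v w = -(((p : ℂ) - 1) * p ^ ((m + 3) / 2)) := by
  have h3 : Even (m + 3) := hm.add_odd (by decide)
  rw [← sq_eq_sq_iff_eq_or_eq_neg, D_sq_of_finrank hp hF hζ (by rwa [h]), h,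
    mul_pow, ← pow_mul, Nat.div_mul_cancel h3.two_dvd]

/-- The possible values of `D(u,v,w)` for `w ≠ 0`. -/
theorem D_values (hp : p ≠ 2) (hm : Odd m) (hmk : Nat.gcd m k = 1) (hF : Fintype.card F = p ^ m)
    (hζ : IsPrimitiveRoot ζ p) (u v : F) {w : F} (hw : w ≠ 0) :
    D p k F ζ u v w = 0 ∨
    (D p k F ζ u v w = ((p : ℂ) - 1) * p ^ ((m + 1) / 2) ∨
      D p k F ζ u v w = -(((p : ℂ) - 1) * p ^ ((m + 1) / 2))) ∨
    (D p k F ζ u v w = ((p : ℂ) - 1) * p ^ ((m + 3) / 2) ∨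
      D p k F ζ u v w = -(((p : ℂ) - 1) * p ^ ((m + 3) / 2))) := by
  by_cases h : Even (m + Module.finrank (ZMod p) (quadForm p k F u v w).radical)
  · have h4 := finrank_radical_le_four (u := u) (v := v) hp
      (by rw [finrank_eq_of_card hF]; exact Nat.Coprime.symm hmk) hw
    have hodd := (Nat.even_add'.mp h).mp hm
    obtain ⟨s, hs⟩ := hodd
    have : s = 0 ∨ s = 1 := by omega
    rcases this with rfl | rfl
    · exact Or.inr (Or.inl (D_of_finrank_one hp hm hF hζ hs))
    · exact Or.inr (Or.inr (D_of_finrank_three hp hm hF hζ hs))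
  · exact Or.inl (D_eq_zero_of_finrank hp hF hζ h)

/-- The possible values of `D(u,v,0)` for `(u,v) ≠ 0`. -/
theorem D_values_zero (hp : p ≠ 2) (hm : Odd m) (hmk : Nat.gcd m k = 1)
    (hF : Fintype.card F = p ^ m) (hζ : IsPrimitiveRoot ζ p) {u v : F} (huv : (u, v) ≠ 0) :
    D p k F ζ u v 0 = 0 ∨
    (D p k F ζ u v 0 = ((p : ℂ) - 1) * p ^ ((m + 1) / 2) ∨
      D p k F ζ u v 0 = -(((p : ℂ) - 1) * p ^ ((m + 1) / 2))) := by
  by_cases h : Even (m + Module.finrank (ZMod p) (quadForm p k F u v 0).radical)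
  · have h2 := finrank_radical_le_two hp
      (by rw [finrank_eq_of_card hF]; exact Nat.Coprime.symm hmk) huv
    have hodd := (Nat.even_add'.mp h).mp hm
    obtain ⟨s, hs⟩ := hodd
    have : s = 0 := by omega
    subst this
    exact Or.inr (D_of_finrank_one hp hm hF hζ hs)
  · exact Or.inl (D_eq_zero_of_finrank hp hF hζ h)

theorem D_zero (hF : Fintype.card F = p ^ m) :
    D p k F ζ 0 0 0 = ((p : ℂ) - 1) * p ^ m := by
  have hp1 : ((p - 1 : ℕ) : ℂ) = (p : ℂ) - 1 := by
    rw [Nat.cast_sub (Fact.out : p.Prime).one_le]; simp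
  simp [D, hF, Nat.totient_prime (Fact.out : p.Prime), hp1]

end Values

end Forms

/-! ### Counting vanishing symmetric tensors, phrased by contracting one factor with functionals. -/

section Tensors

variable {K V : Type*} [Field K] [AddCommGroup V] [Module K V]

/-- The symmetric tensor `y₁ x₁ ⊗ x₁ + y₂ x₂ ⊗ x₂ + t ⊗ a + a ⊗ t` vanishes. -/
def TensorVanishes (y₁ : K) (x₁ : V) (y₂ : K) (x₂ t a : V) : Prop :=
  ∀ f : V →ₗ[K] K, (y₁ * f x₁) • x₁ + (y₂ * f x₂) • x₂ + f a • t + f t • a = 0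

theorem exists_functional_eq_one {x t : V} (h : x ∉ Submodule.span K {t}) :
    ∃ f : V →ₗ[K] K, f x = 1 ∧ f t = 0 := by
  obtain ⟨f, hf, hle⟩ := Submodule.exists_le_ker_of_notMem h
  refine ⟨(f x)⁻¹ • f, by simp [hf], ?_⟩
  have : f t = 0 := hle (Submodule.mem_span_singleton_self t)
  simp [this]

theorem exists_functional_eq_one_of_ne_zero {x : V} (h : x ≠ 0) : ∃ f : V →ₗ[K] K, f x = 1 := by
  obtain ⟨f, hf, -⟩ := exists_functional_eq_one (K := K) (x := x) (t := 0) (by simpa using h)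
  exact ⟨f, hf⟩

/-- With `f t = 1`, the difference of the two relations reads `f(a-b) t + (a-b) = 0`. Applying `f`
again gives `2 f(a-b) = 0`. -/
theorem TensorVanishes.unique (h2 : (2 : K) ≠ 0) {y₁ y₂ : K} {x₁ x₂ t a b : V} (ht : t ≠ 0)
    (ha : TensorVanishes y₁ x₁ y₂ x₂ t a) (hb : TensorVanishes y₁ x₁ y₂ x₂ t b) : a = b := by
  obtain ⟨f, hf⟩ := exists_functional_eq_one_of_ne_zero (K := K) ht
  have h1 : f (a - b) • t + (a - b) = 0 := by
    have h3 := ha f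
    rw [← hb f, hf, add_assoc, add_assoc _ (f b • t), add_left_cancel_iff] at h3
    rw [map_sub, sub_smul]
    linear_combination (norm := module) h3
  have h4 := congrArg f h1
  rw [map_add, map_smul, hf, map_zero, smul_eq_mul, mul_one, ← two_mul] at h4
  have h5 : f (a - b) = 0 := (mul_eq_zero.mp h4).resolve_left h2
  rw [h5, zero_smul, zero_add] at h1
  exact sub_eq_zero.mp h1

/-- If `y₁ x₁ ⊗ x₁ + y₂ x₂ ⊗ x₂` vanishes modulo `t` and `x₂` does not, then `x₁` is a multiple of `x₂`
modulo `t`. -/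
theorem TensorVanishes.exists_eq {y₁ y₂ : Kˣ} {x₁ x₂ t a : V} (hx : x₂ ∉ Submodule.span K {t})
    (h : TensorVanishes (y₁ : K) x₁ (y₂ : K) x₂ t a) :
    ∃ (s : Kˣ) (c : K), y₁ = -y₂ * (s ^ 2)⁻¹ ∧ x₁ = (s : K) • x₂ + c • t := by
  -- Contracting with this `f` leaves `y₁ f(x₁) x₁ + y₂ x₂ + f(a) t = 0`; a second contraction gives
  -- `y₁ f(x₁)² = -y₂`, so `s = f x₁`.
  obtain ⟨f, hfx, hft⟩ := exists_functional_eq_one hx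
  have h1 := h f
  rw [hfx, hft, zero_smul, add_zero, mul_one] at h1
  have hs : f x₁ ≠ 0 := by
    intro h0
    rw [h0, mul_zero, zero_smul, zero_add] at h1
    apply hx
    rw [Submodule.mem_span_singleton]
    refine ⟨-(y₂ : K)⁻¹ * f a, ?_⟩
    have h3 := congrArg ((y₂ : K)⁻¹ • ·) h1
    simp only [smul_add, smul_smul, smul_zero, inv_mul_cancel₀ y₂.ne_zero, one_smul] at h3
    rw [neg_mul, neg_smul]
    exact neg_eq_of_add_eq_zero_left h3
  have h4 : (y₁ : K) * f x₁ * f x₁ + y₂ = 0 := by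
    have := congrArg f h1
    simpa [hfx, hft] using this
  have hy : (y₁ : K) * f x₁ ≠ 0 := mul_ne_zero y₁.ne_zero hs
  refine ⟨Units.mk0 _ hs, -(f a) / (y₁ * f x₁), ?_, ?_⟩
  · ext
    simp only [Units.val_mul, Units.val_neg, Units.val_inv_eq_inv_val, Units.val_pow_eq_pow_val,
      Units.val_mk0]
    field_simp
    linear_combination h4
  · have h5 : x₁ = -((y₂ : K) / (y₁ * f x₁)) • x₂ + (-(f a) / (y₁ * f x₁)) • t := by
      have h3 := congrArg (((y₁ : K) * f x₁)⁻¹ • ·) h1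
      simp only [smul_add, smul_smul, smul_zero, inv_mul_cancel₀ hy, one_smul] at h3
      rw [add_assoc] at h3
      refine (eq_neg_of_add_eq_zero_left h3).trans ?_
      match_scalars <;> ring
    rw [Units.val_mk0]
    have h6 : f x₁ = -((y₂ : K) / (y₁ * f x₁)) := by
      field_simp
      linear_combination h4
    rw [← h6] at h5
    exact h5

/-- Modulo `t` only `y₁ x₁⊗x₁` remains, and it vanishes only if `x₁` does. -/
theorem TensorVanishes.mem_span {y₁ : Kˣ} {y₂ : K} {x₁ x₂ t a : V} (hx : x₂ ∈ Submodule.span K {t})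
    (h : TensorVanishes (y₁ : K) x₁ y₂ x₂ t a) : x₁ ∈ Submodule.span K {t} := by
  by_contra hx₁
  obtain ⟨f, hfx, hft⟩ := exists_functional_eq_one hx₁
  obtain ⟨s, rfl⟩ := Submodule.mem_span_singleton.mp hx
  have h1 := h f
  simp only [hfx, hft, map_smul, smul_zero, mul_zero, zero_smul, add_zero, mul_one] at h1
  apply hx₁
  rw [Submodule.mem_span_singleton]
  refine ⟨-(y₁ : K)⁻¹ * f a, ?_⟩
  have h3 := congrArg ((y₁ : K)⁻¹ • ·) h1
  simp only [smul_add, smul_smul, smul_zero, inv_mul_cancel₀ y₁.ne_zero, one_smul] at h3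
  rw [neg_mul, neg_smul]
  exact (eq_neg_of_add_eq_zero_left h3).symm

/-- The vector `a` is read off by expanding `y₁ x₁⊗x₁ + y₂ x₂⊗x₂`: the `x₂⊗x₂` terms cancel, the
mixed terms give the coefficient of `x₂`, and half of the `t⊗t` term gives that of `t`. -/
theorem tensorVanishes_of_notMem (h2 : (2 : K) ≠ 0) (y₂ s : Kˣ) (c : K) (x₂ t : V) :
    TensorVanishes ((-y₂ * (s ^ 2)⁻¹ : Kˣ) : K) ((s : K) • x₂ + c • t) (y₂ : K) x₂ t
      (((y₂ : K) * c * (s : K)⁻¹) • x₂ + ((y₂ : K) * c ^ 2 * ((s : K) ^ 2)⁻¹ * 2⁻¹) • t) := by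
  intro f
  have hs := s.ne_zero
  simp only [map_add, map_smul, smul_eq_mul, Units.val_mul, Units.val_neg,
    Units.val_inv_eq_inv_val, Units.val_pow_eq_pow_val]
  match_scalars <;> field_simp <;> ring

theorem tensorVanishes_of_mem (h2 : (2 : K) ≠ 0) (y₁ y₂ c d : K) (t : V) :
    TensorVanishes y₁ (c • t) y₂ (d • t) t (-((y₁ * c ^ 2 + y₂ * d ^ 2) * 2⁻¹) • t) := by
  intro f
  simp only [map_smul, smul_eq_mul]
  match_scalars
  field_simp
  ring

/-- For `t ≠ 0` the vector `a` is determined by the rest. If `x₂` is a multiple of `t`, then `y₁` is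
free and `x₁ = c t`; otherwise `x₁ = s x₂ + c t` and `s` determines `y₁`. Both cases are
parametrized by `Kˣ × K`, so the count does not depend on `x₂`. -/
theorem natCard_tensorVanishes_of_ne_zero (h2 : (2 : K) ≠ 0) (y₂ : Kˣ) (x₂ : V) {t : V}
    (ht : t ≠ 0) :
    Nat.card {i : Kˣ × V × V // TensorVanishes (i.1 : K) i.2.1 (y₂ : K) x₂ t i.2.2} =
      Nat.card (Kˣ × K) := by
  symm
  by_cases hx : x₂ ∈ Submodule.span K {t}
  · obtain ⟨d, rfl⟩ := Submodule.mem_span_singleton.mp hx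
    refine Nat.card_congr (Equiv.ofBijective
      (fun i : Kˣ × K => ⟨(i.1, i.2 • t, _), tensorVanishes_of_mem h2 i.1 y₂ i.2 d t⟩) ⟨?_, ?_⟩)
    · rintro ⟨y, c⟩ ⟨y', c'⟩ h
      simp only [Subtype.mk.injEq, Prod.mk.injEq] at h
      exact Prod.ext h.1 (smul_left_injective K ht h.2.1)
    · rintro ⟨⟨y, x, a⟩, h⟩
      obtain ⟨c, rfl⟩ := Submodule.mem_span_singleton.mp (h.mem_span hx)
      refine ⟨(y, c), Subtype.ext ?_⟩
      have := TensorVanishes.unique h2 ht h (tensorVanishes_of_mem h2 y y₂ c d t)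
      simp only at this
      simp [this]
  · refine Nat.card_congr (Equiv.ofBijective
      (fun i : Kˣ × K => ⟨(_, _, _), tensorVanishes_of_notMem h2 y₂ i.1 i.2 x₂ t⟩) ⟨?_, ?_⟩)
    · rintro ⟨s, c⟩ ⟨s', c'⟩ h
      simp only [Subtype.mk.injEq, Prod.mk.injEq] at h
      obtain ⟨f, hfx, hft⟩ := exists_functional_eq_one hx
      have h3 := congrArg f h.2.1
      simp only [map_add, map_smul, hfx, hft, smul_eq_mul, mul_one, mul_zero, add_zero] at h3
      have h4 := h.2.1
      rw [h3, add_left_cancel_iff] at h4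
      exact Prod.ext (Units.ext h3) (smul_left_injective K ht h4)
    · rintro ⟨⟨y, x, a⟩, h⟩
      obtain ⟨s, c, hy, hx₁⟩ := h.exists_eq hx
      simp only at hy hx₁
      subst hy hx₁
      refine ⟨(s, c), Subtype.ext ?_⟩
      have := TensorVanishes.unique h2 ht h (tensorVanishes_of_notMem h2 y₂ s c x₂ t)
      simp only at this
      simp [this]

theorem natCard_tensorVanishes_zero (y₂ : Kˣ) (x₂ : V) :
    Nat.card {i : Kˣ × V // TensorVanishes (i.1 : K) i.2 (y₂ : K) x₂ 0 0} = Nat.card Kˣ := by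
  symm
  by_cases hx : x₂ = 0
  · subst hx
    refine Nat.card_congr (Equiv.ofBijective
      (fun y : Kˣ => ⟨(y, 0), fun f => by simp⟩) ⟨?_, ?_⟩)
    · intro y y' h
      exact congrArg (fun i => i.1.1) h
    · rintro ⟨⟨y, x⟩, h⟩
      have h1 := h.mem_span (Submodule.zero_mem _)
      simp only [Submodule.mem_span_singleton, smul_zero, exists_const] at h1
      exact ⟨y, by simp [← h1]⟩
  · refine Nat.card_congr (Equiv.ofBijective
      (fun s : Kˣ => ⟨(-y₂ * (s ^ 2)⁻¹, (s : K) • x₂), fun f => ?_⟩) ⟨?_, ?_⟩)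
    · have hs := s.ne_zero
      simp only [map_smul, smul_eq_mul, Units.val_mul, Units.val_neg, map_zero,
        Units.val_inv_eq_inv_val, Units.val_pow_eq_pow_val]
      match_scalars
      field_simp
      ring
    · intro s s' h
      exact Units.ext (smul_left_injective K hx (congrArg (fun i => i.1.2) h))
    · rintro ⟨⟨y, x⟩, h⟩
      obtain ⟨s, c, hy, hx₁⟩ := h.exists_eq (by simpa using hx)
      refine ⟨s, Subtype.ext ?_⟩
      simp only at hy hx₁
      simp [hy, hx₁]

end Tensors

/-! ### Orthogonality of additive characters in two and three variables. -/

section Orthogonality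

variable {F I J : Type*} [Field F] [Fintype F] [Fintype I] [Fintype J]

/-- The function on `F³` with frequencies `L i`. -/
def expSum (ψ : AddChar F ℂ) (L : I → F × F × F) (u v w : F) : ℂ :=
  ∑ i, ψ (u * (L i).1 + v * (L i).2.1 + w * (L i).2.2)

omit [Fintype F] in
theorem expSum_mul (ψ : AddChar F ℂ) (L : I → F × F × F) (L' : J → F × F × F) (u v w : F) :
    expSum ψ L u v w * expSum ψ L' u v w =
      expSum ψ (fun ij : I × J => L ij.1 + L' ij.2) u v w := by
  unfold expSum
  rw [Finset.sum_mul_sum, Fintype.sum_prod_type]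
  refine Finset.sum_congr rfl fun i _ => Finset.sum_congr rfl fun j _ => ?_
  rw [← ψ.map_add_eq_mul]
  congr 1
  simp only [Prod.fst_add, Prod.snd_add]
  ring

theorem sum_pair_addChar [DecidableEq F] {ψ : AddChar F ℂ} (hψ : ψ.IsPrimitive) (a b c : F) :
    ∑ x : F × F, ψ (x.1 * a + x.2 * b + c) =
      if a = 0 ∧ b = 0 then (Fintype.card F : ℂ) ^ 2 * ψ c else 0 := by
  have h : ∑ x : F × F, ψ (x.1 * a + x.2 * b + c) =
      (∑ u : F, ψ (u * a)) * (∑ v : F, ψ (v * b)) * ψ c := by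
    rw [Finset.sum_mul_sum, Fintype.sum_prod_type, Finset.sum_mul]
    refine Finset.sum_congr rfl fun u _ => ?_
    rw [Finset.sum_mul]
    exact Finset.sum_congr rfl fun v _ => by rw [ψ.map_add_eq_mul, ψ.map_add_eq_mul]
  rw [h, AddChar.sum_mulShift a hψ, AddChar.sum_mulShift b hψ]
  by_cases ha : a = 0 <;> by_cases hb : b = 0 <;> simp [ha, hb, sq]

/-- `hL` removes the phase in `w` from the surviving terms; this is what makes low moments
computable for each fixed `w`. -/
theorem sum_expSum_pair {ψ : AddChar F ℂ} (hψ : ψ.IsPrimitive) (L : I → F × F × F) (w : F)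
    (hL : ∀ i, (L i).1 = 0 → (L i).2.1 = 0 → (L i).2.2 = 0) :
    ∑ x : F × F, expSum ψ L x.1 x.2 w =
      (Fintype.card F : ℂ) ^ 2 * Nat.card {i // (L i).1 = 0 ∧ (L i).2.1 = 0} := by
  classical
  unfold expSum
  rw [Finset.sum_comm, Finset.sum_congr rfl fun i _ => sum_pair_addChar hψ _ _ _,
    Nat.card_eq_fintype_card, Fintype.card_subtype, Finset.card_filter, Nat.cast_sum,
    Finset.mul_sum]
  refine Finset.sum_congr rfl fun i _ => ?_
  by_cases h : (L i).1 = 0 ∧ (L i).2.1 = 0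
  · simp [h, hL i h.1 h.2]
  · rw [if_neg h, if_neg h]; simp

/-- Summing over `w` as well imposes the third equation, so no analogue of `hL` is needed. -/
theorem sum_expSum_triple {ψ : AddChar F ℂ} (hψ : ψ.IsPrimitive) (L : I → F × F × F) :
    ∑ w : F, ∑ x : F × F, expSum ψ L x.1 x.2 w =
      (Fintype.card F : ℂ) ^ 3 * Nat.card {i // L i = 0} := by
  classical
  unfold expSum
  have h1 : ∀ w : F, ∑ x : F × F, ∑ i, ψ (x.1 * (L i).1 + x.2 * (L i).2.1 + w * (L i).2.2) =
      ∑ i, if (L i).1 = 0 ∧ (L i).2.1 = 0 then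
        (Fintype.card F : ℂ) ^ 2 * ψ (w * (L i).2.2) else 0 := by
    intro w
    rw [Finset.sum_comm]
    exact Finset.sum_congr rfl fun i _ => sum_pair_addChar hψ _ _ _
  rw [Finset.sum_congr rfl fun w _ => h1 w, Finset.sum_comm,
    Nat.card_eq_fintype_card, Fintype.card_subtype, Finset.card_filter, Nat.cast_sum,
    Finset.mul_sum]
  refine Finset.sum_congr rfl fun i _ => ?_
  have h2 : L i = 0 ↔ ((L i).1 = 0 ∧ (L i).2.1 = 0) ∧ (L i).2.2 = 0 := by
    rw [Prod.ext_iff, Prod.ext_iff]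
    simp [and_assoc]
  by_cases h : (L i).1 = 0 ∧ (L i).2.1 = 0
  · simp only [if_pos h]
    rw [← Finset.mul_sum, AddChar.sum_mulShift _ hψ]
    by_cases h' : (L i).2.2 = 0
    · rw [if_pos h', if_pos (h2.mpr ⟨h, h'⟩)]; push_cast; ring
    · rw [if_neg h', if_neg (fun h3 => h' (h2.mp h3).2)]; simp
  · simp only [if_neg h]
    rw [if_neg (fun h3 => h (h2.mp h3).1)]; simp

end Orthogonality

/-! ### Moments as exponential sums, and their equations as vanishing of tensors. -/

section Moments

variable {p k : ℕ} [Fact p.Prime] {F : Type*} [Field F] [Fintype F] [Algebra (ZMod p) F]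
  {ζ : ℂ}

variable (F) in
/-- The additive character `x ↦ ζ ^ Tr x`. -/
def traceChar (hζ : IsPrimitiveRoot ζ p) : AddChar F ℂ :=
  (AddChar.zmodChar p hζ.pow_eq_one).compAddMonoidHom
    (Algebra.trace (ZMod p) F).toAddMonoidHom

omit [Fintype F] in
theorem traceChar_apply (hζ : IsPrimitiveRoot ζ p) (x : F) : traceChar F hζ x =
    AddChar.zmodChar p hζ.pow_eq_one (Algebra.trace (ZMod p) F x) := rfl

omit [Fintype F] in
theorem traceChar_eq_one_iff (hζ : IsPrimitiveRoot ζ p) (x : F) :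
    traceChar F hζ x = 1 ↔ Algebra.trace (ZMod p) F x = 0 := by
  rw [traceChar_apply]
  exact (isPrimitive_zmodChar hζ).zmod_char_eq_one_iff p _

theorem isPrimitive_traceChar (hζ : IsPrimitiveRoot ζ p) : (traceChar F hζ).IsPrimitive := by
  intro b hb h
  apply hb
  apply eq_zero_of_trace_mul_eq_zero (p := p)
  intro a
  rw [← traceChar_eq_one_iff hζ, mul_comm]
  simpa using DFunLike.congr_fun h a

variable (p k F) in
/-- The vectors `y (x², x^(p^k+1), x^(p^(2k)+1))`. -/
def pointVec (i : (ZMod p)ˣ × F) : F × F × F :=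
  (algebraMap (ZMod p) F i.1 * (i.2 * i.2), algebraMap (ZMod p) F i.1 * (i.2 * frobPow p k F i.2),
    algebraMap (ZMod p) F i.1 * (i.2 * frobPow p k F (frobPow p k F i.2)))

variable (p k F) in
/-- The polarized vectors. -/
def polarVec (i : F × F) : F × F × F :=
  (2 * (i.2 * i.1), i.2 * frobPow p k F i.1 + i.1 * frobPow p k F i.2,
    i.2 * frobPow p k F (frobPow p k F i.1) + i.1 * frobPow p k F (frobPow p k F i.2))

theorem D_eq_expSum (hζ : IsPrimitiveRoot ζ p) (u v w : F) :
    D p k F ζ u v w = expSum (traceChar F hζ) (pointVec p k F) u v w := by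
  rw [D_eq_scaledExpSum hζ.pow_eq_one, scaledExpSum, expSum, Fintype.sum_prod_type]
  refine Finset.sum_congr rfl fun y _ => Finset.sum_congr rfl fun x _ => ?_
  rw [traceChar_apply, quadForm_apply, ← smul_eq_mul, ← map_smul, Algebra.smul_def]
  congr 2
  simp only [pointVec]
  ring

/-- For fixed `t` the sum over `a` runs over a character of `F`, which is trivial exactly when `t`
lies in the radical. -/
theorem card_radical_eq_expSum (hp : p ≠ 2) (hζ : IsPrimitiveRoot ζ p) (u v w : F) :
    (Fintype.card F : ℂ) * Nat.card (quadForm p k F u v w).radical =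
      expSum (traceChar F hζ) (polarVec p k F) u v w := by
  classical
  rw [expSum, Fintype.sum_prod_type]
  have h : ∀ t : F, ∑ a : F, traceChar F hζ (u * (polarVec p k F (t, a)).1 +
      v * (polarVec p k F (t, a)).2.1 + w * (polarVec p k F (t, a)).2.2) =
      if t ∈ (quadForm p k F u v w).radical then (Fintype.card F : ℂ) else 0 := by
    intro t
    let g : F →+ F :=
      { toFun := fun a => polarPoly p k F u v w a t
        map_zero' := by simp [polarPoly]
        map_add' := fun a b => by simp only [polarPoly, map_add]; ring }
    have hg : ∑ a : F, traceChar F hζ (u * (polarVec p k F (t, a)).1 +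
      v * (polarVec p k F (t, a)).2.1 + w * (polarVec p k F (t, a)).2.2) =
        ∑ a, (traceChar F hζ).compAddMonoidHom g a := rfl
    rw [hg]
    split_ifs with ht
    · refine AddChar.sum_eq_card_of_eq_one ?_
      ext a
      rw [mem_radical_quadForm hp] at ht
      exact (traceChar_eq_one_iff hζ _).mpr (ht a)
    · refine AddChar.sum_eq_zero_of_ne_one fun h1 => ht ?_
      rw [mem_radical_quadForm hp]
      intro a
      exact (traceChar_eq_one_iff hζ _).mp (DFunLike.congr_fun h1 a)
  rw [Finset.sum_congr rfl fun t _ => h t, ← Finset.sum_filter, Finset.sum_const, nsmul_eq_mul,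
    mul_comm]
  congr 2
  rw [Nat.card_eq_fintype_card, Fintype.card_subtype]

/-- The map `x⊗y ↦ x g(y)` applied to the zero tensor, obtained by expanding `g` in a basis. -/
theorem TensorVanishes.apply_linearMap {y₁ y₂ : ZMod p} {x₁ x₂ t a : F}
    (h : TensorVanishes y₁ x₁ y₂ x₂ t a) (g : F →ₗ[ZMod p] F) :
    algebraMap (ZMod p) F y₁ * (x₁ * g x₁) + algebraMap (ZMod p) F y₂ * (x₂ * g x₂) +
      (a * g t + t * g a) = 0 := by
  let b := Module.finBasis (ZMod p) F
  have hg : ∀ x, g x = ∑ l, algebraMap (ZMod p) F (b.coord l x) * g (b l) := by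
    intro x
    conv_lhs => rw [← b.sum_repr x, map_sum]
    refine Finset.sum_congr rfl fun l _ => ?_
    rw [map_smul, Algebra.smul_def, b.coord_apply]
  rw [hg x₁, hg x₂, hg t, hg a]
  simp only [Finset.mul_sum]
  rw [← Finset.sum_add_distrib, ← Finset.sum_add_distrib, ← Finset.sum_add_distrib]
  refine Finset.sum_eq_zero fun l _ => ?_
  have h1 := congrArg (· * g (b l)) (h (b.coord l))
  simp only [Algebra.smul_def, map_mul, zero_mul] at h1
  rw [← h1]
  ring

variable (hk : Nat.Coprime k (Module.finrank (ZMod p) F))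
include hk

theorem tensorVanishes_iff {y₁ y₂ : ZMod p} {x₁ x₂ t a : F} :
    TensorVanishes y₁ x₁ y₂ x₂ t a ↔
      (algebraMap (ZMod p) F y₁ * (x₁ * x₁) + algebraMap (ZMod p) F y₂ * (x₂ * x₂) +
        2 * (a * t) = 0 ∧
      algebraMap (ZMod p) F y₁ * (x₁ * frobPow p k F x₁) +
        algebraMap (ZMod p) F y₂ * (x₂ * frobPow p k F x₂) +
        (a * frobPow p k F t + t * frobPow p k F a) = 0) ∧
      algebraMap (ZMod p) F y₁ * (x₁ * frobPow p k F (frobPow p k F x₁)) +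
        algebraMap (ZMod p) F y₂ * (x₂ * frobPow p k F (frobPow p k F x₂)) +
        (a * frobPow p k F (frobPow p k F t) + t * frobPow p k F (frobPow p k F a)) = 0 := by
  set σ := frobPow p k F with hσ
  constructor
  · intro h
    refine ⟨⟨?_, h.apply_linearMap (σ : F ≃ₐ[ZMod p] F).toLinearMap⟩,
      h.apply_linearMap ((σ : F ≃ₐ[ZMod p] F).toLinearMap ∘ₗ (σ : F ≃ₐ[ZMod p] F).toLinearMap)⟩
    have := h.apply_linearMap LinearMap.id
    rw [← this]
    simp only [LinearMap.id_apply]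
    ring
  · rintro ⟨⟨h0, h1⟩, h2⟩ f
    -- The tensor has four terms, so four consecutive conjugate relations suffice. By symmetry
    -- `σ^(-j)` turns the `j`-th equation into the relation for `-j`; the three equations thus cover
    -- the window -2, -1, 0, 1, which starts at `ρ = σ⁻²`.
    have := sum_mul_functional_eq_zero hk ![x₁, x₂, a, t]
      ![algebraMap (ZMod p) F y₁ * x₁, algebraMap (ZMod p) F y₂ * x₂, t, a] (σ⁻¹ * σ⁻¹) ?_ f
    · simp only [Fin.sum_univ_four, Matrix.cons_val] at this
      simp only [Algebra.smul_def, map_mul]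
      rw [← this]
      ring
    · intro j hj
      rw [Fintype.card_fin] at hj
      simp only [Fin.sum_univ_four, Matrix.cons_val, AlgEquiv.mul_apply, AlgEquiv.aut_inv, ← hσ]
      interval_cases j
      · apply σ.injective
        apply σ.injective
        rw [map_zero, map_zero, ← h2]
        simp only [Function.iterate_zero, id, map_add, map_mul, AlgEquiv.commutes,
          AlgEquiv.apply_symm_apply]
        ring
      · apply σ.injective
        rw [map_zero, ← h1]
        simp only [Function.iterate_succ, Function.iterate_zero, Function.comp_apply, id, map_add,
          map_mul, AlgEquiv.commutes, AlgEquiv.apply_symm_apply]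
        ring
      · rw [← h0]
        simp only [Function.iterate_succ, Function.iterate_zero, Function.comp_apply, id,
          AlgEquiv.apply_symm_apply]
        ring
      · rw [← h1]
        simp only [Function.iterate_succ, Function.iterate_zero, Function.comp_apply, id,
          AlgEquiv.apply_symm_apply]
        ring

/-- With three terms the window -1, 0, 1 suffices, so the equations for exponents 0 and 1 imply the
one for 2. This permits the third moment at fixed `w`. -/
theorem tensorVanishes_of_single {y₁ y₂ : ZMod p} {x₁ t a : F}
    (h0 : algebraMap (ZMod p) F y₁ * (x₁ * x₁) + 2 * (a * t) = 0)
    (h1 : algebraMap (ZMod p) F y₁ * (x₁ * frobPow p k F x₁) +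
        (a * frobPow p k F t + t * frobPow p k F a) = 0) :
    TensorVanishes y₁ x₁ y₂ 0 t a := by
  set σ := frobPow p k F with hσ
  intro f
  have := sum_mul_functional_eq_zero hk ![x₁, a, t]
    ![algebraMap (ZMod p) F y₁ * x₁, t, a] σ⁻¹ ?_ f
  · simp only [Fin.sum_univ_three, Matrix.cons_val] at this
    simp only [Algebra.smul_def, map_mul, mul_zero, add_zero]
    rw [← this]
    ring
  · intro j hj
    rw [Fintype.card_fin] at hj
    simp only [Fin.sum_univ_three, Matrix.cons_val, AlgEquiv.aut_inv, ← hσ]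
    interval_cases j
    · apply σ.injective
      rw [map_zero, ← h1]
      simp only [Function.iterate_zero, id, map_add,
        map_mul, AlgEquiv.commutes, AlgEquiv.apply_symm_apply]
      ring
    · rw [← h0]
      simp only [Function.iterate_succ, Function.iterate_zero, Function.comp_apply, id,
        AlgEquiv.apply_symm_apply]
      ring
    · rw [← h1]
      simp only [Function.iterate_succ, Function.iterate_zero, Function.comp_apply, id,
        AlgEquiv.apply_symm_apply]
      ring

/-- Two terms need only the window 0, 1; this serves the second moment. -/
theorem tensorVanishes_of_pair {y₁ y₂ : ZMod p} {x₁ x₂ : F}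
    (h0 : algebraMap (ZMod p) F y₁ * (x₁ * x₁) + algebraMap (ZMod p) F y₂ * (x₂ * x₂) = 0)
    (h1 : algebraMap (ZMod p) F y₁ * (x₁ * frobPow p k F x₁) +
        algebraMap (ZMod p) F y₂ * (x₂ * frobPow p k F x₂) = 0) :
    TensorVanishes y₁ x₁ y₂ x₂ 0 0 := by
  set σ := frobPow p k F with hσ
  intro f
  have := sum_mul_functional_eq_zero hk ![x₁, x₂]
    ![algebraMap (ZMod p) F y₁ * x₁, algebraMap (ZMod p) F y₂ * x₂] 1 ?_ f
  · simp only [Fin.sum_univ_two, Matrix.cons_val] at this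
    simp only [Algebra.smul_def, map_mul, mul_zero, add_zero]
    linear_combination this
  · intro j hj
    rw [Fintype.card_fin] at hj
    simp only [Fin.sum_univ_two, Matrix.cons_val, AlgEquiv.one_apply, ← hσ]
    interval_cases j
    · rw [← h0]
      simp only [Function.iterate_zero, id]
      ring
    · rw [← h1]
      simp only [Function.iterate_succ, Function.iterate_zero, Function.comp_apply, id]
      ring

end Moments

/-! ### Solution counts over `𝔽_p`. -/

section Counts

variable {p : ℕ} [Fact p.Prime] {F : Type*} [Field F] [Fintype F] [Algebra (ZMod p) F]

theorem natCard_units_zmod : Nat.card (ZMod p)ˣ = p - 1 := by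
  rw [Nat.card_eq_fintype_card, ZMod.card_units]

theorem cast_pred_prime : ((p - 1 : ℕ) : ℂ) = (p : ℂ) - 1 := by
  rw [Nat.cast_sub (Fact.out : p.Prime).one_le, Nat.cast_one]

theorem natCard_sigma_const {α β : Type*} [Fintype α] [Finite β] {P : β → α → Prop} {n : ℕ}
    (h : ∀ a, Nat.card {b // P b a} = n) : Nat.card {i : β × α // P i.1 i.2} = Nat.card α * n := by
  have e : {i : β × α // P i.1 i.2} ≃ Σ a, {b // P b a} :=
    { toFun := fun i => ⟨i.1.2, i.1.1, i.2⟩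
      invFun := fun i => ⟨(i.2.1, i.1), i.2.2⟩
      left_inv := fun _ => rfl
      right_inv := fun _ => rfl }
  rw [Nat.card_congr e, Nat.card_sigma, Finset.sum_congr rfl fun a _ => h a]
  simp

theorem natCard_tensorVanishes_pair :
    Nat.card {i : ((ZMod p)ˣ × F) × ((ZMod p)ˣ × F) //
      TensorVanishes (i.1.1 : ZMod p) i.1.2 (i.2.1 : ZMod p) i.2.2 0 0} =
      (p - 1) * Fintype.card F * (p - 1) := by
  rw [natCard_sigma_const (P := fun (b a : (ZMod p)ˣ × F) =>
    TensorVanishes (b.1 : ZMod p) b.2 (a.1 : ZMod p) a.2 0 0) (n := p - 1)]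
  · rw [Nat.card_prod, natCard_units_zmod, Nat.card_eq_fintype_card]
  · rintro ⟨y₂, x₂⟩
    rw [← natCard_units_zmod]
    exact natCard_tensorVanishes_zero y₂ x₂

/-- The number of `(y₁, x₁, t, a)` for which the tensor vanishes, for given `y₂` and `x₂`. -/
theorem natCard_tensorVanishes_polar (hp : p ≠ 2) (y₂ : (ZMod p)ˣ) (x₂ : F) :
    Nat.card {i : ((ZMod p)ˣ × F) × (F × F) //
      TensorVanishes (i.1.1 : ZMod p) i.1.2 (y₂ : ZMod p) x₂ i.2.1 i.2.2} =
      (p - 1) * Fintype.card F + (Fintype.card F - 1) * ((p - 1) * p) := by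
  classical
  have e : {i : ((ZMod p)ˣ × F) × (F × F) //
      TensorVanishes (i.1.1 : ZMod p) i.1.2 (y₂ : ZMod p) x₂ i.2.1 i.2.2} ≃
      Σ t : F, {i : (ZMod p)ˣ × F × F //
        TensorVanishes (i.1 : ZMod p) i.2.1 (y₂ : ZMod p) x₂ t i.2.2} :=
    { toFun := fun i => ⟨i.1.2.1, (i.1.1.1, i.1.1.2, i.1.2.2), i.2⟩
      invFun := fun i => ⟨((i.2.1.1, i.2.1.2.1), (i.1, i.2.1.2.2)), i.2.2⟩
      left_inv := fun _ => rfl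
      right_inv := fun _ => rfl }
  -- For `t = 0` both terms containing `a` vanish, so `a` is unconstrained.
  have e0 : {i : (ZMod p)ˣ × F × F //
      TensorVanishes (i.1 : ZMod p) i.2.1 (y₂ : ZMod p) x₂ 0 i.2.2} ≃
      {i : (ZMod p)ˣ × F // TensorVanishes (i.1 : ZMod p) i.2 (y₂ : ZMod p) x₂ 0 0} × F :=
    { toFun := fun i => (⟨(i.1.1, i.1.2.1), fun f => by simpa using i.2 f⟩, i.1.2.2)
      invFun := fun i => ⟨(i.1.1.1, i.1.1.2, i.2), fun f => by simpa using i.1.2 f⟩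
      left_inv := fun _ => rfl
      right_inv := fun _ => rfl }
  rw [Nat.card_congr e, Nat.card_sigma, Fintype.sum_eq_add_sum_compl 0, Nat.card_congr e0,
    Nat.card_prod, natCard_tensorVanishes_zero, natCard_units_zmod, Nat.card_eq_fintype_card]
  congr 1
  rw [Finset.sum_congr rfl (g := fun _ => (p - 1) * p)]
  · rw [Finset.sum_const, Finset.card_compl, Finset.card_singleton, smul_eq_mul]
  · intro t ht
    rw [natCard_tensorVanishes_of_ne_zero (two_ne_zero_zmod hp) y₂ x₂ (by simpa using ht),
      Nat.card_prod, natCard_units_zmod, Nat.card_zmod]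

theorem natCard_tensorVanishes (hp : p ≠ 2) :
    Nat.card {i : (((ZMod p)ˣ × F) × ((ZMod p)ˣ × F)) × (F × F) //
      TensorVanishes (i.1.1.1 : ZMod p) i.1.1.2 (i.1.2.1 : ZMod p) i.1.2.2 i.2.1 i.2.2} =
      (p - 1) * Fintype.card F *
        ((p - 1) * Fintype.card F + (Fintype.card F - 1) * ((p - 1) * p)) := by
  have e : {i : (((ZMod p)ˣ × F) × ((ZMod p)ˣ × F)) × (F × F) //
      TensorVanishes (i.1.1.1 : ZMod p) i.1.1.2 (i.1.2.1 : ZMod p) i.1.2.2 i.2.1 i.2.2} ≃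
      {i : (((ZMod p)ˣ × F) × (F × F)) × ((ZMod p)ˣ × F) //
      TensorVanishes (i.1.1.1 : ZMod p) i.1.1.2 (i.2.1 : ZMod p) i.2.2 i.1.2.1 i.1.2.2} :=
    { toFun := fun i => ⟨((i.1.1.1, i.1.2), i.1.1.2), i.2⟩
      invFun := fun i => ⟨((i.1.1.1, i.1.2), i.1.1.2), i.2⟩
      left_inv := fun _ => rfl
      right_inv := fun _ => rfl }
  rw [Nat.card_congr e, natCard_sigma_const
    (P := fun (b : ((ZMod p)ˣ × F) × (F × F)) (a : (ZMod p)ˣ × F) =>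
    TensorVanishes (b.1.1 : ZMod p) b.1.2 (a.1 : ZMod p) a.2 b.2.1 b.2.2)
    fun a => natCard_tensorVanishes_polar hp a.1 a.2]
  rw [Nat.card_prod, natCard_units_zmod, Nat.card_eq_fintype_card]

end Counts

/-! ### The first four moments of `D`. -/

section Moments

variable {p k m : ℕ} [Fact p.Prime] {F : Type*} [Field F] [Fintype F] [Algebra (ZMod p) F]
  {ζ : ℂ}

theorem sum_D (hF : Fintype.card F = p ^ m) (hζ : IsPrimitiveRoot ζ p) (w : F) :
    ∑ x : F × F, D p k F ζ x.1 x.2 w = ((p : ℂ) ^ m) ^ 2 * ((p : ℂ) - 1) := by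
  have h0 : ∀ i : (ZMod p)ˣ × F, (pointVec p k F i).1 = 0 → i.2 = 0 := by
    intro i hi
    have hy : algebraMap (ZMod p) F i.1 ≠ 0 := (map_ne_zero _).mpr i.1.ne_zero
    simpa [pointVec, hy] using hi
  simp only [D_eq_expSum hζ]
  rw [sum_expSum_pair (isPrimitive_traceChar hζ), hF, Nat.cast_pow]
  · congr 1
    have e : {i : (ZMod p)ˣ × F // (pointVec p k F i).1 = 0 ∧ (pointVec p k F i).2.1 = 0} ≃
        (ZMod p)ˣ :=
      { toFun := fun i => i.1.1
        invFun := fun y => ⟨(y, 0), by simp [pointVec], by simp [pointVec]⟩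
        left_inv := fun i => Subtype.ext (Prod.ext rfl (h0 i.1 i.2.1).symm)
        right_inv := fun _ => rfl }
    rw [Nat.card_congr e, natCard_units_zmod, cast_pred_prime]
  · intro i hi _
    simp [pointVec, h0 i hi]

theorem pointVec_add_pointVec_vanishes (hk : Nat.Coprime k (Module.finrank (ZMod p) F))
    (i j : (ZMod p)ˣ × F) :
    ((pointVec p k F i + pointVec p k F j).1 = 0 ∧ (pointVec p k F i + pointVec p k F j).2.1 = 0) ↔
      TensorVanishes (i.1 : ZMod p) i.2 (j.1 : ZMod p) j.2 0 0 := by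
  constructor
  · rintro ⟨h0, h1⟩
    exact tensorVanishes_of_pair hk h0 h1
  · intro h
    obtain ⟨⟨h0, h1⟩, -⟩ := (tensorVanishes_iff hk).mp h
    simpa [pointVec] using And.intro h0 h1

theorem sum_D_sq (hmk : Nat.gcd m k = 1) (hF : Fintype.card F = p ^ m) (hζ : IsPrimitiveRoot ζ p)
    (w : F) :
    ∑ x : F × F, D p k F ζ x.1 x.2 w ^ 2 =
      ((p : ℂ) ^ m) ^ 2 * (((p : ℂ) - 1) * p ^ m * ((p : ℂ) - 1)) := by
  have hk : Nat.Coprime k (Module.finrank (ZMod p) F) := by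
    rw [finrank_eq_of_card hF]; exact Nat.Coprime.symm hmk
  simp only [D_eq_expSum hζ, sq (expSum _ _ _ _ _), expSum_mul]
  rw [sum_expSum_pair (isPrimitive_traceChar hζ)]
  · simp only [pointVec_add_pointVec_vanishes hk]
    rw [natCard_tensorVanishes_pair, hF]
    push_cast [cast_pred_prime]
    ring
  · intro i h0 h1
    have h := (tensorVanishes_iff hk).mp ((pointVec_add_pointVec_vanishes hk i.1 i.2).mp ⟨h0, h1⟩)
    simpa [pointVec] using h.2

/-- The dummy choice `y₂ = 1`, `x₂ = 0` makes this an instance of the general count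
`natCard_tensorVanishes_polar`. -/
theorem pointVec_add_polarVec_vanishes (hk : Nat.Coprime k (Module.finrank (ZMod p) F))
    (i : (ZMod p)ˣ × F) (j : F × F) :
    ((pointVec p k F i + polarVec p k F j).1 = 0 ∧ (pointVec p k F i + polarVec p k F j).2.1 = 0) ↔
      TensorVanishes (i.1 : ZMod p) i.2 ((1 : (ZMod p)ˣ) : ZMod p) 0 j.1 j.2 := by
  constructor
  · rintro ⟨h0, h1⟩
    exact tensorVanishes_of_single hk h0 h1
  · intro h
    obtain ⟨⟨h0, h1⟩, -⟩ := (tensorVanishes_iff hk).mp h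
    simp only [mul_zero, add_zero, map_zero] at h0 h1
    exact ⟨h0, h1⟩

theorem sum_D_pow_three (hp : p ≠ 2) (hmk : Nat.gcd m k = 1) (hF : Fintype.card F = p ^ m)
    (hζ : IsPrimitiveRoot ζ p) (w : F) :
    ∑ x : F × F, D p k F ζ x.1 x.2 w ^ 3 = ((p : ℂ) - 1) ^ 2 * (((p : ℂ) ^ m) ^ 2 *
      (((p : ℂ) - 1) * p ^ m + ((p : ℂ) ^ m - 1) * (((p : ℂ) - 1) * p))) := by
  have hk : Nat.Coprime k (Module.finrank (ZMod p) F) := by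
    rw [finrank_eq_of_card hF]; exact Nat.Coprime.symm hmk
  have h1 : ∀ x : F × F, D p k F ζ x.1 x.2 w ^ 3 = ((p : ℂ) - 1) ^ 2 *
      expSum (traceChar F hζ) (fun ij : ((ZMod p)ˣ × F) × (F × F) =>
        pointVec p k F ij.1 + polarVec p k F ij.2) x.1 x.2 w := by
    intro x
    rw [← expSum_mul, ← D_eq_expSum, ← card_radical_eq_expSum hp, D_pow_three hp hF hζ, hF]
    push_cast
    ring
  rw [Finset.sum_congr rfl fun x _ => h1 x, ← Finset.mul_sum,
    sum_expSum_pair (isPrimitive_traceChar hζ)]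
  · simp only [pointVec_add_polarVec_vanishes hk]
    rw [natCard_tensorVanishes_polar hp, hF]
    push_cast [cast_pred_prime, Nat.cast_sub (Nat.one_le_pow m p (Fact.out : p.Prime).pos)]
    ring
  · intro i h0 h1
    have h := (tensorVanishes_iff hk).mp ((pointVec_add_polarVec_vanishes hk i.1 i.2).mp ⟨h0, h1⟩)
    have h2 := h.2
    simp only [mul_zero, add_zero, map_zero] at h2
    exact h2

theorem pointVec_add_pointVec_add_polarVec_eq_zero
    (hk : Nat.Coprime k (Module.finrank (ZMod p) F)) (i i' : (ZMod p)ˣ × F) (j : F × F) :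
    pointVec p k F i + pointVec p k F i' + polarVec p k F j = 0 ↔
      TensorVanishes (i.1 : ZMod p) i.2 (i'.1 : ZMod p) i'.2 j.1 j.2 := by
  rw [tensorVanishes_iff hk, Prod.ext_iff, Prod.ext_iff, and_assoc]
  rfl

theorem sum_D_pow_four (hp : p ≠ 2) (hmk : Nat.gcd m k = 1) (hF : Fintype.card F = p ^ m)
    (hζ : IsPrimitiveRoot ζ p) :
    ∑ w : F, ∑ x : F × F, D p k F ζ x.1 x.2 w ^ 4 = ((p : ℂ) - 1) ^ 2 * (((p : ℂ) ^ m) ^ 3 *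
      (((p : ℂ) - 1) * p ^ m *
        (((p : ℂ) - 1) * p ^ m + ((p : ℂ) ^ m - 1) * (((p : ℂ) - 1) * p)))) := by
  have hk : Nat.Coprime k (Module.finrank (ZMod p) F) := by
    rw [finrank_eq_of_card hF]; exact Nat.Coprime.symm hmk
  have h1 : ∀ (w : F) (x : F × F), D p k F ζ x.1 x.2 w ^ 4 = ((p : ℂ) - 1) ^ 2 *
      expSum (traceChar F hζ) (fun ij : (((ZMod p)ˣ × F) × ((ZMod p)ˣ × F)) × (F × F) =>
        pointVec p k F ij.1.1 + pointVec p k F ij.1.2 + polarVec p k F ij.2) x.1 x.2 w := by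
    intro w x
    rw [← expSum_mul _ (fun ij : ((ZMod p)ˣ × F) × ((ZMod p)ˣ × F) =>
      pointVec p k F ij.1 + pointVec p k F ij.2), ← expSum_mul, ← D_eq_expSum,
      ← card_radical_eq_expSum hp, D_pow_four hp hF hζ, hF]
    push_cast
    ring
  rw [Finset.sum_congr rfl fun w _ => Finset.sum_congr rfl fun x _ => h1 w x]
  simp only [← Finset.mul_sum]
  rw [sum_expSum_triple (isPrimitive_traceChar hζ)]
  simp only [pointVec_add_pointVec_add_polarVec_eq_zero hk]
  rw [natCard_tensorVanishes hp, hF]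
  push_cast [cast_pred_prime, Nat.cast_sub (Nat.one_le_pow m p (Fact.out : p.Prime).pos)]
  ring

end Moments

/-! ### Independence of `w ≠ 0` by scaling. -/

section Scaling

variable {p k m : ℕ} [Fact p.Prime] {F : Type*} [Field F] [Fintype F] [Algebra (ZMod p) F]
  {ζ : ℂ}

/-- Substitution of `a x` for `x` and of `z y` for the scalar `z`. -/
theorem D_scale (hζ : ζ ^ p = 1) (y : (ZMod p)ˣ) {a : F} (ha : a ≠ 0) (u v w : F) :
    D p k F ζ (u * (algebraMap (ZMod p) F y * (a * a)))
      (v * (algebraMap (ZMod p) F y * (a * frobPow p k F a)))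
      (w * (algebraMap (ZMod p) F y * (a * frobPow p k F (frobPow p k F a)))) =
      D p k F ζ u v w := by
  rw [D_eq_scaledExpSum hζ, D_eq_scaledExpSum hζ, scaledExpSum, scaledExpSum]
  refine Fintype.sum_bijective (· * y) (Group.mulRight_bijective y) _ _ fun z => ?_
  refine Fintype.sum_bijective (a * ·) (mulLeft_bijective₀ a ha) _ _ fun x => ?_
  rw [quadForm_apply, quadForm_apply, Units.val_mul, mul_assoc (z : ZMod p), ← smul_eq_mul (y : ZMod p),
    ← map_smul, Algebra.smul_def]
  congr 3
  simp only [map_mul]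
  ring

variable (p k F) in
/-- The homomorphism `(y, a) ↦ y a^(p^(2k)+1)`. -/
def scaleHom : (ZMod p)ˣ × Fˣ →* Fˣ where
  toFun x := Units.map (algebraMap (ZMod p) F).toMonoidHom x.1 *
    (x.2 * Units.map ((frobPow p k F * frobPow p k F : F ≃ₐ[ZMod p] F) : F →* F) x.2)
  map_one' := by simp
  map_mul' x y := by
    simp only [Prod.fst_mul, Prod.snd_mul, map_mul]
    ac_rfl

theorem scaleHom_apply (x : (ZMod p)ˣ × Fˣ) : (scaleHom p k F x : F) =
    algebraMap (ZMod p) F x.1 * (x.2 * frobPow p k F (frobPow p k F x.2)) := rfl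

/-- The domain is `p - 1` times as large as `Fˣ`, so it suffices that the kernel has at most `p - 1`
elements. If `y a σ²(a) = 1`, applying `σ²` and comparing gives `σ⁴ a = a`; as `4k` is prime to the
odd number `m`, `a` lies in `𝔽_p`, and then `y = a⁻²`. -/
theorem scaleHom_surjective (hm : Odd m) (hmk : Nat.gcd m k = 1) (hF : Fintype.card F = p ^ m) :
    Function.Surjective (scaleHom p k F) := by
  have hk : Nat.Coprime (k * 4) (Module.finrank (ZMod p) F) := by
    rw [finrank_eq_of_card hF]
    refine Nat.Coprime.mul_left (Nat.Coprime.symm hmk) ?_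
    have : Nat.Coprime (2 ^ 2) m := Nat.Coprime.pow_left 2 hm.coprime_two_left
    exact this
  have hker : ∀ x ∈ (scaleHom p k F).ker, ∃ c : (ZMod p)ˣ,
      x = ((c ^ 2)⁻¹, Units.map (algebraMap (ZMod p) F).toMonoidHom c) := by
    rintro ⟨y, a⟩ hx
    rw [MonoidHom.mem_ker] at hx
    have h1 := congrArg Units.val hx
    rw [scaleHom_apply] at h1
    set σ := frobPow p k F with hσ
    simp only [Units.val_one] at h1
    have h2 := congrArg (fun z => σ (σ z)) h1
    simp only [map_mul, AlgEquiv.commutes, map_one] at h2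
    have h3 : frobPow p (k * 4) F (a : F) = a := by
      have h4 : frobPow p (k * 4) F (a : F) = σ (σ (σ (σ (a : F)))) := by
        simp only [hσ, frobPow_apply, ← pow_mul, ← pow_add]
        congr 2
        ring
      rw [h4]
      have hy : algebraMap (ZMod p) F y ≠ 0 := (map_ne_zero _).mpr y.ne_zero
      have hs : σ (σ (a : F)) ≠ 0 := by simp
      apply mul_left_cancel₀ (mul_ne_zero hy hs)
      linear_combination h2 - h1
    obtain ⟨c, hc⟩ := mem_range_algebraMap_of_frobPow_eq hk h3
    have hc0 : c ≠ 0 := by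
      rintro rfl
      exact a.ne_zero (by rw [← hc, map_zero])
    refine ⟨Units.mk0 c hc0, ?_⟩
    have ha : a = Units.map (algebraMap (ZMod p) F).toMonoidHom (Units.mk0 c hc0) :=
      Units.ext hc.symm
    refine Prod.ext ?_ ha
    rw [← hc] at h1
    simp only [AlgEquiv.commutes, ← map_mul] at h1
    have h5 : (y : ZMod p) * (c * c) = 1 := (algebraMap (ZMod p) F).injective (by rw [h1, map_one])
    rw [eq_inv_iff_mul_eq_one]
    ext
    simpa [sq] using h5
  have hcard : Nat.card (scaleHom p k F).ker ≤ p - 1 := by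
    rw [← natCard_units_zmod (p := p)]
    choose g hg using hker
    refine Nat.card_le_card_of_injective (fun x : (scaleHom p k F).ker => g x.1 x.2) ?_
    intro x x' h
    apply Subtype.ext
    rw [hg x.1 x.2, hg x'.1 x'.2]
    exact congrArg (fun c : (ZMod p)ˣ =>
      ((c ^ 2)⁻¹, Units.map (algebraMap (ZMod p) F).toMonoidHom c)) h
  have hindex := (scaleHom p k F).ker.card_mul_index
  rw [Subgroup.index_ker, Nat.card_prod, natCard_units_zmod] at hindex
  rw [← MonoidHom.range_eq_top]
  apply Subgroup.eq_top_of_le_card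
  have hp1 : 0 < p - 1 := Nat.sub_pos_of_lt (Fact.out : p.Prime).one_lt
  refine Nat.le_of_mul_le_mul_left ?_ hp1
  rw [← hindex]
  exact Nat.mul_le_mul_right _ hcard

/-- Sums over `u` and `v` do not depend on `w ≠ 0`. -/
theorem sum_D_eq_sum_D_one {R : Type*} [AddCommMonoid R] (hm : Odd m) (hmk : Nat.gcd m k = 1)
    (hF : Fintype.card F = p ^ m) (hζ : IsPrimitiveRoot ζ p) (g : ℂ → R) {w : F} (hw : w ≠ 0) :
    ∑ x : F × F, g (D p k F ζ x.1 x.2 w) = ∑ x : F × F, g (D p k F ζ x.1 x.2 1) := by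
  obtain ⟨⟨y, a⟩, h⟩ := scaleHom_surjective hm hmk hF (Units.mk0 w hw)
  have h1 := congrArg Units.val h
  rw [scaleHom_apply, Units.val_mk0] at h1
  have hy : algebraMap (ZMod p) F y ≠ 0 := (map_ne_zero _).mpr y.ne_zero
  symm
  refine Fintype.sum_bijective (Prod.map
    (· * (algebraMap (ZMod p) F y * (a * a)))
    (· * (algebraMap (ZMod p) F y * (a * frobPow p k F a)))) (Function.Bijective.prodMap
      (mulRight_bijective₀ _ (by simp [hy])) (mulRight_bijective₀ _ (by simp [hy]))) _ _ fun x => ?_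
  rw [← h1, Prod.map_fst, Prod.map_snd, ← D_scale hζ.pow_eq_one y a.ne_zero x.1 x.2 1, one_mul]

theorem sum_D_pow_four_eq (hp : p ≠ 2) (hm : Odd m) (hmk : Nat.gcd m k = 1)
    (hF : Fintype.card F = p ^ m) (hζ : IsPrimitiveRoot ζ p) {w : F} (hw : w ≠ 0) :
    ∑ x : F × F, D p k F ζ x.1 x.2 0 ^ 4 +
      ((p : ℂ) ^ m - 1) * ∑ x : F × F, D p k F ζ x.1 x.2 w ^ 4 =
      ((p : ℂ) - 1) ^ 2 * (((p : ℂ) ^ m) ^ 3 * (((p : ℂ) - 1) * p ^ m *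
        (((p : ℂ) - 1) * p ^ m + ((p : ℂ) ^ m - 1) * (((p : ℂ) - 1) * p)))) := by
  classical
  rw [← sum_D_pow_four (k := k) hp hmk hF hζ,
    Fintype.sum_eq_add_sum_compl 0 (fun w => ∑ x : F × F, D p k F ζ x.1 x.2 w ^ 4)]
  congr 1
  rw [Finset.sum_congr (s₁ := ({0}ᶜ : Finset F)) rfl
    (g := fun _ => ∑ x : F × F, D p k F ζ x.1 x.2 w ^ 4)]
  · rw [Finset.sum_const, Finset.card_compl, Finset.card_singleton, nsmul_eq_mul, hF,
      Nat.cast_sub (Nat.one_le_pow m p (Fact.out : p.Prime).pos)]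
    push_cast
    ring
  · intro w' hw'
    have hw'' : w' ≠ 0 := by simpa using hw'
    rw [sum_D_eq_sum_D_one hm hmk hF hζ (· ^ 4) hw'', sum_D_eq_sum_D_one hm hmk hF hζ (· ^ 4) hw]

end Scaling

/-! ### Solving the moment equations. -/

section Counting

theorem sum_comp_eq_sum_card {X R : Type*} [Fintype X] [Semiring R] (f : X → ℂ)
    (s : Finset ℂ) (hs : ∀ x, f x ∈ s) (g : ℂ → R) :
    ∑ x, g (f x) = ∑ z ∈ s, (Nat.card {x // f x = z} : R) * g z := by
  classical
  rw [← Finset.sum_fiberwise_of_maps_to (fun x _ => hs x)]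
  refine Finset.sum_congr rfl fun z _ => ?_
  rw [Finset.sum_congr rfl (g := fun _ => g z) fun x hx => by rw [(Finset.mem_filter.mp hx).2],
    Finset.sum_const, nsmul_eq_mul, Nat.card_eq_fintype_card, Fintype.card_subtype]

/-- Solution of the moment equations with the values `0`, `±a` and `±p a`. -/
theorem solve_moments {p P n₀ s₁ s₂ t₁ t₂ : ℂ} (hp0 : p ≠ 0) (hp1 : p - 1 ≠ 0) (hp2 : p + 1 ≠ 0)
    (hP : P ≠ 0) (hq : p ^ 3 * P ^ 2 - 1 ≠ 0) {a : ℂ} (ha : a = (p - 1) * (p ^ 2 * P))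
    (e0 : n₀ + s₁ + s₂ + t₁ + t₂ = (p ^ 3 * P ^ 2) ^ 2)
    (e1 : s₁ * a + s₂ * (-a) + t₁ * (p * a) + t₂ * (-(p * a)) = (p ^ 3 * P ^ 2) ^ 2 * (p - 1))
    (e2 : s₁ * a ^ 2 + s₂ * (-a) ^ 2 + t₁ * (p * a) ^ 2 + t₂ * (-(p * a)) ^ 2 =
      (p ^ 3 * P ^ 2) ^ 2 * ((p - 1) * (p ^ 3 * P ^ 2) * (p - 1)))
    (e3 : s₁ * a ^ 3 + s₂ * (-a) ^ 3 + t₁ * (p * a) ^ 3 + t₂ * (-(p * a)) ^ 3 =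
      (p - 1) ^ 2 * ((p ^ 3 * P ^ 2) ^ 2 * ((p - 1) * (p ^ 3 * P ^ 2) +
        ((p ^ 3 * P ^ 2) - 1) * ((p - 1) * p))))
    (e4 : (((p - 1) * (p ^ 3 * P ^ 2)) ^ 4 +
        a ^ 4 * ((p ^ 3 * P ^ 2 - 1) * (p ^ 2 * P ^ 2))) +
        (p ^ 3 * P ^ 2 - 1) * (s₁ * a ^ 4 + s₂ * (-a) ^ 4 + t₁ * (p * a) ^ 4 +
          t₂ * (-(p * a)) ^ 4) =
      (p - 1) ^ 2 * ((p ^ 3 * P ^ 2) ^ 3 * ((p - 1) * (p ^ 3 * P ^ 2) *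
        ((p - 1) * (p ^ 3 * P ^ 2) + ((p ^ 3 * P ^ 2) - 1) * ((p - 1) * p))))) :
    n₀ = p ^ 6 * P ^ 4 - p ^ 5 * P ^ 4 + p ^ 2 * P ^ 4 - P ^ 2 ∧
    s₁ = (p ^ 5 * P ^ 2 - p ^ 3 * P ^ 2 - p ^ 2 * P ^ 2 + 1) * (p ^ 2 * P ^ 2 + p * P) /
      (2 * (p ^ 2 - 1)) ∧
    s₂ = (p ^ 5 * P ^ 2 - p ^ 3 * P ^ 2 - p ^ 2 * P ^ 2 + 1) * (p ^ 2 * P ^ 2 - p * P) /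
      (2 * (p ^ 2 - 1)) ∧
    t₁ = (p ^ 2 * P ^ 2 - 1) * (P ^ 2 + P) / (2 * (p ^ 2 - 1)) ∧
    t₂ = (p ^ 2 * P ^ 2 - 1) * (P ^ 2 - P) / (2 * (p ^ 2 - 1)) := by
  -- Here `m = 2l + 3` and `P = p^l`, so `p³P² = p^m` and `a = (p-1) p^((m+1)/2)`. The first bracket
  -- in `e4` is the fourth moment at `w = 0`. Odd moments determine the differences `s₁ - s₂`, `t₁ -
  -- t₂`, and even moments the sums.
  have ha0 : a ≠ 0 := by rw [ha]; exact mul_ne_zero hp1 (mul_ne_zero (pow_ne_zero _ hp0) hP)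
  have hpp : p ^ 2 - 1 ≠ 0 := by
    rw [show p ^ 2 - 1 = (p - 1) * (p + 1) by ring]; exact mul_ne_zero hp1 hp2
  have d3 : (p ^ 2 - 1) * (t₁ - t₂) = (p ^ 2 * P ^ 2 - 1) * P := by
    apply mul_left_cancel₀ (mul_ne_zero hp0 (pow_ne_zero 3 ha0))
    have h : p * a ^ 3 * ((p ^ 2 - 1) * (t₁ - t₂)) = ((p - 1) ^ 2 * ((p ^ 3 * P ^ 2) ^ 2 *
        ((p - 1) * (p ^ 3 * P ^ 2) + ((p ^ 3 * P ^ 2) - 1) * ((p - 1) * p)))) -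
        a ^ 2 * ((p ^ 3 * P ^ 2) ^ 2 * (p - 1)) := by linear_combination e3 - a ^ 2 * e1
    rw [h, ha]; ring
  have d1 : (p ^ 2 - 1) * (s₁ - s₂) =
      (p ^ 5 * P ^ 2 - p ^ 3 * P ^ 2 - p ^ 2 * P ^ 2 + 1) * (p * P) := by
    apply mul_left_cancel₀ ha0
    have h : a * ((p ^ 2 - 1) * (s₁ - s₂)) = (p ^ 2 - 1) * ((p ^ 3 * P ^ 2) ^ 2 * (p - 1)) -
        p * a * ((p ^ 2 * P ^ 2 - 1) * P) := by
      linear_combination (p ^ 2 - 1) * e1 - p * a * d3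
    rw [h, ha]; ring
  have c3 : (p ^ 2 - 1) * (t₁ + t₂) = (p ^ 2 * P ^ 2 - 1) * P ^ 2 := by
    apply mul_left_cancel₀ (mul_ne_zero (mul_ne_zero hq (pow_ne_zero 2 hp0)) (pow_ne_zero 4 ha0))
    have h : (p ^ 3 * P ^ 2 - 1) * p ^ 2 * a ^ 4 * ((p ^ 2 - 1) * (t₁ + t₂)) =
        (p - 1) ^ 2 * ((p ^ 3 * P ^ 2) ^ 3 * ((p - 1) * (p ^ 3 * P ^ 2) *
        ((p - 1) * (p ^ 3 * P ^ 2) + ((p ^ 3 * P ^ 2) - 1) * ((p - 1) * p)))) -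
        (((p - 1) * (p ^ 3 * P ^ 2)) ^ 4 +
        a ^ 4 * ((p ^ 3 * P ^ 2 - 1) * (p ^ 2 * P ^ 2))) -
        (p ^ 3 * P ^ 2 - 1) * a ^ 2 *
          ((p ^ 3 * P ^ 2) ^ 2 * ((p - 1) * (p ^ 3 * P ^ 2) * (p - 1))) := by
      linear_combination e4 - (p ^ 3 * P ^ 2 - 1) * a ^ 2 * e2
    rw [h, ha]; ring
  have c1 : (p ^ 2 - 1) * (s₁ + s₂) =
      (p ^ 5 * P ^ 2 - p ^ 3 * P ^ 2 - p ^ 2 * P ^ 2 + 1) * (p ^ 2 * P ^ 2) := by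
    apply mul_left_cancel₀ (pow_ne_zero 2 ha0)
    have h : a ^ 2 * ((p ^ 2 - 1) * (s₁ + s₂)) =
        (p ^ 2 - 1) * ((p ^ 3 * P ^ 2) ^ 2 * ((p - 1) * (p ^ 3 * P ^ 2) * (p - 1))) -
        p ^ 2 * a ^ 2 * ((p ^ 2 * P ^ 2 - 1) * P ^ 2) := by
      linear_combination (p ^ 2 - 1) * e2 - p ^ 2 * a ^ 2 * c3
    rw [h, ha]; ring
  refine ⟨?_, ?_, ?_, ?_, ?_⟩
  · apply mul_left_cancel₀ hpp
    linear_combination (p ^ 2 - 1) * e0 - c1 - c3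
  all_goals
    rw [eq_div_iff (mul_ne_zero two_ne_zero hpp)]
  · linear_combination c1 + d1
  · linear_combination c1 - d1
  · linear_combination c3 + d3
  · linear_combination c3 - d3

/-- Solution of the moment equations with the values `0`, `±a` and one value attained once. -/
theorem solve_moments_zero {p P n₀ s₁ s₂ : ℂ} (hp0 : p ≠ 0) (hp1 : p - 1 ≠ 0)
    (hP : P ≠ 0) {a : ℂ} (ha : a = (p - 1) * (p ^ 2 * P))
    (e0 : 1 + n₀ + s₁ + s₂ = (p ^ 3 * P ^ 2) ^ 2)
    (e1 : (p - 1) * (p ^ 3 * P ^ 2) + s₁ * a + s₂ * (-a) = (p ^ 3 * P ^ 2) ^ 2 * (p - 1))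
    (e2 : ((p - 1) * (p ^ 3 * P ^ 2)) ^ 2 + s₁ * a ^ 2 + s₂ * (-a) ^ 2 =
      (p ^ 3 * P ^ 2) ^ 2 * ((p - 1) * (p ^ 3 * P ^ 2) * (p - 1))) :
    n₀ = (p ^ 3 * P ^ 2 - 1) * (p ^ 3 * P ^ 2 - p ^ 2 * P ^ 2 + 1) ∧
    s₁ = (p ^ 3 * P ^ 2 - 1) * (p ^ 2 * P ^ 2 + p * P) / 2 ∧
    s₂ = (p ^ 3 * P ^ 2 - 1) * (p ^ 2 * P ^ 2 - p * P) / 2 := by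
  have ha0 : a ≠ 0 := by rw [ha]; exact mul_ne_zero hp1 (mul_ne_zero (pow_ne_zero _ hp0) hP)
  have d1 : s₁ - s₂ = (p ^ 3 * P ^ 2 - 1) * (p * P) := by
    apply mul_left_cancel₀ ha0
    have h : a * (s₁ - s₂) = (p ^ 3 * P ^ 2) ^ 2 * (p - 1) - (p - 1) * (p ^ 3 * P ^ 2) := by
      linear_combination e1
    rw [h, ha]; ring
  have c1 : s₁ + s₂ = (p ^ 3 * P ^ 2 - 1) * (p ^ 2 * P ^ 2) := by
    apply mul_left_cancel₀ (pow_ne_zero 2 ha0)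
    have h : a ^ 2 * (s₁ + s₂) = (p ^ 3 * P ^ 2) ^ 2 * ((p - 1) * (p ^ 3 * P ^ 2) * (p - 1)) -
        ((p - 1) * (p ^ 3 * P ^ 2)) ^ 2 := by
      linear_combination e2
    rw [h, ha]; ring
  refine ⟨?_, ?_, ?_⟩
  · linear_combination e0 - c1
  · linear_combination (c1 + d1) / 2
  · linear_combination (c1 - d1) / 2

end Counting

/-! ### Frequencies of the values of `D`. -/

section Frequencies

theorem ne_neg_self_complex {a : ℂ} (ha : a ≠ 0) : a ≠ -a := by
  intro h
  apply ha
  linear_combination h / 2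

theorem sum_five_values {M : Type*} [AddCommMonoid M] {a r : ℂ} (ha : a ≠ 0) (hr : r ≠ 0)
    (hr1 : r - 1 ≠ 0) (hr2 : r + 1 ≠ 0) (h : ℂ → M) :
    ∑ z ∈ ({0, a, -a, r * a, -(r * a)} : Finset ℂ), h z =
      h 0 + (h a + (h (-a) + (h (r * a) + h (-(r * a))))) := by
  have hra := mul_ne_zero hr ha
  have h1 : a ≠ r * a := fun e => mul_ne_zero hr1 ha (by linear_combination -e)
  have h2 : a ≠ -(r * a) := fun e => mul_ne_zero hr2 ha (by linear_combination e)
  rw [Finset.sum_insert, Finset.sum_insert, Finset.sum_insert, Finset.sum_insert,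
    Finset.sum_singleton]
  · simpa using ne_neg_self_complex hra
  · simp only [Finset.mem_insert, Finset.mem_singleton, not_or]
    exact ⟨fun e => h2 (by rw [← e, neg_neg]), fun e => h1 (neg_injective e)⟩
  · simp only [Finset.mem_insert, Finset.mem_singleton, not_or]
    exact ⟨ne_neg_self_complex ha, h1, h2⟩
  · simp only [Finset.mem_insert, Finset.mem_singleton, not_or, zero_eq_neg]
    exact ⟨ha.symm, ha, hra.symm, hra⟩

theorem sum_four_values {M : Type*} [AddCommMonoid M] {a r : ℂ} (ha : a ≠ 0) (hr : r ≠ 0)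
    (hr1 : r - 1 ≠ 0) (hr2 : r + 1 ≠ 0) (h : ℂ → M) :
    ∑ z ∈ ({r * a, 0, a, -a} : Finset ℂ), h z = h (r * a) + (h 0 + (h a + h (-a))) := by
  have hra := mul_ne_zero hr ha
  rw [Finset.sum_insert, Finset.sum_insert, Finset.sum_insert, Finset.sum_singleton]
  · simpa using ne_neg_self_complex ha
  · simp only [Finset.mem_insert, Finset.mem_singleton, not_or, zero_eq_neg]
    exact ⟨ha.symm, ha⟩
  · simp only [Finset.mem_insert, Finset.mem_singleton, not_or]
    exact ⟨hra, fun e => mul_ne_zero hr1 ha (by linear_combination e),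
      fun e => mul_ne_zero hr2 ha (by linear_combination e)⟩

variable {p k m : ℕ} [Fact p.Prime] {F : Type*} [Field F] [Fintype F] [Algebra (ZMod p) F]
  {ζ : ℂ}

theorem cast_sub_one_ne_zero {n : ℕ} (hn : 2 ≤ n) : (n : ℂ) - 1 ≠ 0 := by
  rw [sub_ne_zero]
  exact_mod_cast (by omega : n ≠ 1)

variable (p m) in
/-- The value `(p-1) p^((m+1)/2)`. -/
def valA : ℂ := ((p : ℂ) - 1) * p ^ ((m + 1) / 2)

theorem valA_ne_zero : valA p m ≠ 0 :=
  mul_ne_zero (cast_sub_one_ne_zero (Fact.out : p.Prime).two_le)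
    (pow_ne_zero _ (Nat.cast_ne_zero.mpr (Fact.out : p.Prime).ne_zero))

omit [Fact p.Prime] in
theorem mul_valA : (p : ℂ) * valA p m = ((p : ℂ) - 1) * p ^ ((m + 3) / 2) := by
  rw [valA, show (m + 3) / 2 = (m + 1) / 2 + 1 by omega, pow_succ]
  ring

omit [Fact p.Prime] in
theorem pow_mul_valA (hm : Odd m) :
    ((p ^ ((m - 1) / 2) : ℕ) : ℂ) * valA p m = ((p : ℂ) - 1) * p ^ m := by
  obtain ⟨n, rfl⟩ := hm
  rw [valA, show (2 * n + 1 - 1) / 2 = n by omega, show (2 * n + 1 + 1) / 2 = n + 1 by omega]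
  push_cast
  ring

theorem two_le_pow_half (hm5 : 5 ≤ m) : 2 ≤ p ^ ((m - 1) / 2) :=
  (Fact.out : p.Prime).two_le.trans (Nat.le_self_pow (by omega) p)

theorem sum_D_comp_zero {R : Type*} [Semiring R] (hp : p ≠ 2) (hm : Odd m) (hm5 : 5 ≤ m)
    (hmk : Nat.gcd m k = 1) (hF : Fintype.card F = p ^ m) (hζ : IsPrimitiveRoot ζ p) (g : ℂ → R) :
    ∑ x : F × F, g (D p k F ζ x.1 x.2 0) = g (((p : ℂ) - 1) * p ^ m) +
      ((Nat.card {x : F × F // D p k F ζ x.1 x.2 0 = 0} : R) * g 0 +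
      ((Nat.card {x : F × F // D p k F ζ x.1 x.2 0 = valA p m} : R) * g (valA p m) +
      (Nat.card {x : F × F // D p k F ζ x.1 x.2 0 = -valA p m} : R) * g (-valA p m))) := by
  classical
  -- The exceptional value `(p-1) p^m`, taken at the origin, is `r` times `valA`; `r ≥ 2` separates
  -- it from the other values.
  set r : ℂ := ((p ^ ((m - 1) / 2) : ℕ) : ℂ)
  have hr := two_le_pow_half (p := p) hm5
  have hr0 : r ≠ 0 := Nat.cast_ne_zero.mpr (by omega)
  have hr1 : r - 1 ≠ 0 := cast_sub_one_ne_zero hr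
  have hr2 : r + 1 ≠ 0 := Nat.cast_add_one_ne_zero _
  have hmem : ∀ x : F × F, D p k F ζ x.1 x.2 0 ∈
      ({r * valA p m, 0, valA p m, -valA p m} : Finset ℂ) := by
    intro x
    by_cases hx : x = 0
    · rw [hx, pow_mul_valA hm]
      exact Finset.mem_insert.mpr (Or.inl (D_zero hF))
    · refine Finset.mem_insert_of_mem ?_
      simpa [valA] using D_values_zero hp hm hmk hF hζ hx
  have hone : Nat.card {x : F × F // D p k F ζ x.1 x.2 0 = r * valA p m} = 1 := by
    rw [Nat.card_eq_one_iff_unique]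
    refine ⟨⟨?_⟩, ⟨0, by rw [pow_mul_valA hm]; exact D_zero hF⟩⟩
    have h0 : ∀ x : F × F, D p k F ζ x.1 x.2 0 = r * valA p m → x = 0 := by
      intro x hx
      by_contra hx0
      have ha := valA_ne_zero (p := p) (m := m)
      rcases D_values_zero hp hm hmk hF hζ hx0 with h | h | h
      · exact mul_ne_zero hr0 ha (hx ▸ h)
      · exact mul_ne_zero hr1 ha (by rw [valA] at hx ⊢; linear_combination h - hx)
      · exact mul_ne_zero hr2 ha (by rw [valA] at hx ⊢; linear_combination h - hx)
    intro x y
    exact Subtype.ext ((h0 x.1 x.2).trans (h0 y.1 y.2).symm)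
  rw [sum_comp_eq_sum_card _ _ hmem, sum_four_values valA_ne_zero hr0 hr1 hr2, hone,
    pow_mul_valA hm, Nat.cast_one, one_mul]

theorem sum_D_comp_ne_zero {R : Type*} [Semiring R] (hp : p ≠ 2) (hm : Odd m)
    (hmk : Nat.gcd m k = 1) (hF : Fintype.card F = p ^ m) (hζ : IsPrimitiveRoot ζ p) {w : F}
    (hw : w ≠ 0) (g : ℂ → R) :
    ∑ x : F × F, g (D p k F ζ x.1 x.2 w) =
      (Nat.card {x : F × F // D p k F ζ x.1 x.2 w = 0} : R) * g 0 +
      ((Nat.card {x : F × F // D p k F ζ x.1 x.2 w = valA p m} : R) * g (valA p m) +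
      ((Nat.card {x : F × F // D p k F ζ x.1 x.2 w = -valA p m} : R) * g (-valA p m) +
      ((Nat.card {x : F × F // D p k F ζ x.1 x.2 w = p * valA p m} : R) * g (p * valA p m) +
      (Nat.card {x : F × F // D p k F ζ x.1 x.2 w = -(p * valA p m)} : R) *
        g (-(p * valA p m))))) := by
  classical
  have hmem : ∀ x : F × F, D p k F ζ x.1 x.2 w ∈
      ({0, valA p m, -valA p m, (p : ℂ) * valA p m, -((p : ℂ) * valA p m)} : Finset ℂ) := by
    intro x
    have := D_values hp hm hmk hF hζ x.1 x.2 hw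
    rw [← mul_valA, ← valA] at this
    simpa [or_assoc] using this
  rw [sum_comp_eq_sum_card _ _ hmem, sum_five_values valA_ne_zero
    (Nat.cast_ne_zero.mpr (Fact.out : p.Prime).ne_zero)
    (cast_sub_one_ne_zero (Fact.out : p.Prime).two_le) (Nat.cast_add_one_ne_zero p)]

omit [Fact p.Prime] in
theorem valA_eq {l : ℕ} : valA p (2 * l + 3) = ((p : ℂ) - 1) * ((p : ℂ) ^ 2 * (p : ℂ) ^ l) := by
  rw [valA, show (2 * l + 3 + 1) / 2 = 2 + l by omega, pow_add]

omit [Fact p.Prime] in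
theorem pow_two_mul_add_three {R : Type*} [CommSemiring R] (l : ℕ) :
    (p : R) ^ (2 * l + 3) = (p : R) ^ 3 * ((p : R) ^ l) ^ 2 := by ring

omit [Fact p.Prime] [Field F] [Algebra (ZMod p) F] in
theorem card_pair (hF : Fintype.card F = p ^ m) :
    ∑ _x : F × F, (1 : ℂ) = ((p : ℂ) ^ m) ^ 2 := by
  rw [Finset.sum_const, Finset.card_univ, Fintype.card_prod, hF]
  simp [sq]

/-- The frequencies for `w = 0`. -/
theorem card_D_zero (hp : p ≠ 2) (hm : Odd m) (hm5 : 5 ≤ m) (hmk : Nat.gcd m k = 1)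
    (hF : Fintype.card F = p ^ m) (hζ : IsPrimitiveRoot ζ p) :
    (Nat.card {x : F × F // D p k F ζ x.1 x.2 0 = 0} : ℚ) = n0 p m ∧
    (Nat.card {x : F × F // D p k F ζ x.1 x.2 0 = valA p m} : ℚ) = nE p m 1 ∧
    (Nat.card {x : F × F // D p k F ζ x.1 x.2 0 = -valA p m} : ℚ) = nE p m (-1) := by
  obtain ⟨l, rfl⟩ : ∃ l, m = 2 * l + 3 := by
    obtain ⟨n, rfl⟩ := hm
    exact ⟨n - 1, by omega⟩
  have hpp : p.Prime := Fact.out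
  have hp0 : (p : ℂ) ≠ 0 := Nat.cast_ne_zero.mpr hpp.ne_zero
  have m0 := sum_D_comp_zero hp hm hm5 hmk hF hζ (fun _ => (1 : ℂ))
  have m1 := sum_D_comp_zero hp hm hm5 hmk hF hζ (fun z => z)
  have m2 := sum_D_comp_zero hp hm hm5 hmk hF hζ (fun z => z ^ 2)
  rw [card_pair hF] at m0
  rw [sum_D hF hζ] at m1
  rw [sum_D_sq hmk hF hζ] at m2
  simp only [mul_one, mul_zero, ne_eq, OfNat.ofNat_ne_zero, not_false_eq_true, zero_pow,
    zero_add, pow_two_mul_add_three] at m0 m1 m2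
  have h := solve_moments_zero
    (n₀ := (Nat.card {x : F × F // D p k F ζ x.1 x.2 0 = 0} : ℂ))
    (s₁ := (Nat.card {x : F × F // D p k F ζ x.1 x.2 0 = valA p (2 * l + 3)} : ℂ))
    (s₂ := (Nat.card {x : F × F // D p k F ζ x.1 x.2 0 = -valA p (2 * l + 3)} : ℂ)) hp0 (cast_sub_one_ne_zero hpp.two_le) (pow_ne_zero l hp0)
    (valA_eq (p := p) (l := l)) (by rw [m0]; ring)
    (by rw [m1]; ring) (by rw [m2]; ring)
  refine ⟨?_, ?_, ?_⟩ <;> apply Rat.cast_injective (α := ℂ)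
  · rw [Rat.cast_natCast, h.1]
    simp only [n0, show 2 * l + 3 - 1 = 2 * l + 2 by omega]
    push_cast
    ring
  · rw [Rat.cast_natCast, h.2.1]
    simp only [nE, show 2 * l + 3 - 1 = 2 * l + 2 by omega, show (2 * l + 2) / 2 = l + 1 by omega]
    push_cast
    ring
  · rw [Rat.cast_natCast, h.2.2]
    simp only [nE, show 2 * l + 3 - 1 = 2 * l + 2 by omega, show (2 * l + 2) / 2 = l + 1 by omega]
    push_cast
    ring

/-- The frequencies for `w ≠ 0`. -/
theorem card_D_ne_zero (hp : p ≠ 2) (hm : Odd m) (hm5 : 5 ≤ m) (hmk : Nat.gcd m k = 1)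
    (hF : Fintype.card F = p ^ m) (hζ : IsPrimitiveRoot ζ p) {w : F} (hw : w ≠ 0) :
    (Nat.card {x : F × F // D p k F ζ x.1 x.2 w = 0} : ℚ) = n0s p m ∧
    (Nat.card {x : F × F // D p k F ζ x.1 x.2 w = valA p m} : ℚ) = nE1 p m 1 ∧
    (Nat.card {x : F × F // D p k F ζ x.1 x.2 w = -valA p m} : ℚ) = nE1 p m (-1) ∧
    (Nat.card {x : F × F // D p k F ζ x.1 x.2 w = p * valA p m} : ℚ) = nE3 p m 1 ∧
    (Nat.card {x : F × F // D p k F ζ x.1 x.2 w = -(p * valA p m)} : ℚ) = nE3 p m (-1) := by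
  have hc := card_D_zero (k := k) hp hm hm5 hmk hF hζ
  have hpp : p.Prime := Fact.out
  have hp0 : (p : ℂ) ≠ 0 := Nat.cast_ne_zero.mpr hpp.ne_zero
  have m0 := sum_D_comp_ne_zero hp hm hmk hF hζ hw (fun _ => (1 : ℂ))
  have m1 := sum_D_comp_ne_zero hp hm hmk hF hζ hw (fun z => z)
  have m2 := sum_D_comp_ne_zero hp hm hmk hF hζ hw (fun z => z ^ 2)
  have m3 := sum_D_comp_ne_zero hp hm hmk hF hζ hw (fun z => z ^ 3)
  have m4 := sum_D_pow_four_eq hp hm hmk hF hζ hw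
  rw [sum_D_comp_ne_zero hp hm hmk hF hζ hw (fun z => z ^ 4),
    sum_D_comp_zero hp hm hm5 hmk hF hζ (fun z => z ^ 4)] at m4
  rw [card_pair hF] at m0
  rw [sum_D hF hζ] at m1
  rw [sum_D_sq hmk hF hζ] at m2
  rw [sum_D_pow_three hp hmk hF hζ] at m3
  obtain ⟨l, rfl⟩ : ∃ l, m = 2 * l + 3 := by
    obtain ⟨n, rfl⟩ := hm
    exact ⟨n - 1, by omega⟩
  have s1 := congrArg (Rat.cast (K := ℂ)) hc.2.1
  have s2 := congrArg (Rat.cast (K := ℂ)) hc.2.2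
  simp only [Rat.cast_natCast, nE, show 2 * l + 3 - 1 = 2 * l + 2 by omega,
    show (2 * l + 2) / 2 = l + 1 by omega] at s1 s2
  push_cast at s1 s2
  -- The known frequencies at `w = 0` are substituted, so that only the `w ≠ 0` part of the fourth
  -- moment remains unknown.
  rw [s1, s2] at m4
  simp only [mul_one, mul_zero, ne_eq, OfNat.ofNat_ne_zero, not_false_eq_true, zero_pow,
    zero_add, pow_two_mul_add_three] at m0 m1 m2 m3 m4
  have hq : (p : ℂ) ^ 3 * ((p : ℂ) ^ l) ^ 2 - 1 ≠ 0 := by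
    rw [← pow_two_mul_add_three]
    exact_mod_cast cast_sub_one_ne_zero
      (hpp.two_le.trans (Nat.le_self_pow (by omega : 2 * l + 3 ≠ 0) p))
  have h := solve_moments
    (n₀ := (Nat.card {x : F × F // D p k F ζ x.1 x.2 w = 0} : ℂ))
    (s₁ := (Nat.card {x : F × F // D p k F ζ x.1 x.2 w = valA p (2 * l + 3)} : ℂ))
    (s₂ := (Nat.card {x : F × F // D p k F ζ x.1 x.2 w = -valA p (2 * l + 3)} : ℂ))
    (t₁ := (Nat.card {x : F × F // D p k F ζ x.1 x.2 w = p * valA p (2 * l + 3)} : ℂ))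
    (t₂ := (Nat.card {x : F × F // D p k F ζ x.1 x.2 w = -(p * valA p (2 * l + 3))} : ℂ)) hp0 (cast_sub_one_ne_zero hpp.two_le) (Nat.cast_add_one_ne_zero p)
    (pow_ne_zero l hp0) hq (valA_eq (p := p) (l := l)) (by rw [m0]; ring) (by rw [m1]; ring)
    (by rw [m2]; ring) (by rw [m3]; ring) (by rw [← m4]; ring)
  refine ⟨?_, ?_, ?_, ?_, ?_⟩ <;> apply Rat.cast_injective (α := ℂ) <;> rw [Rat.cast_natCast]
  · rw [h.1]
    simp only [n0s, show 2 * (2 * l + 3) - 1 = 4 * l + 5 by omega,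
      show 2 * (2 * l + 3) - 4 = 4 * l + 2 by omega, show 2 * l + 3 - 3 = 2 * l by omega]
    push_cast
    ring
  · rw [h.2.1]
    simp only [nE1, show 2 * l + 3 - 1 = 2 * l + 2 by omega, show (2 * l + 2) / 2 = l + 1 by omega]
    push_cast
    ring
  · rw [h.2.2.1]
    simp only [nE1, show 2 * l + 3 - 1 = 2 * l + 2 by omega, show (2 * l + 2) / 2 = l + 1 by omega]
    push_cast
    ring
  · rw [h.2.2.2.1]
    simp only [nE3, show 2 * l + 3 - 1 = 2 * l + 2 by omega, show 2 * l + 3 - 3 = 2 * l by omega,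
      show 2 * l / 2 = l by omega]
    push_cast
    ring
  · rw [h.2.2.2.2]
    simp only [nE3, show 2 * l + 3 - 1 = 2 * l + 2 by omega, show 2 * l + 3 - 3 = 2 * l by omega,
      show 2 * l / 2 = l by omega]
    push_cast
    ring

end Frequencies

/-! ### Convolution, change of variables, and distinctness of the listed values. -/

section Table

/-- The convolution of the distributions for `w = 0` and `w ≠ 0` with themselves. -/
theorem convolution_eq (δ : ℂ → ℚ) (r q A B : ℂ) (N n e₁ e₂ s₀ s₁ s₂ t₁ t₂ : ℚ)
    {φ ψ : ℂ → ℚ}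
    (hφ : ∀ d, φ d = δ (d + r * q) + (n * δ (d + 0) + (e₁ * δ (d + r * A) + e₂ * δ (d + -(r * A)))))
    (hψ : ∀ d, ψ d = s₀ * δ (d + 0) + (s₁ * δ (d + r * A) + (s₂ * δ (d + -(r * A)) +
      (t₁ * δ (d + r * B) + t₂ * δ (d + -(r * B)))))) :
    φ (r * q) + (n * φ 0 + (e₁ * φ (r * A) + e₂ * φ (-(r * A)))) +
      N * (s₀ * ψ 0 + (s₁ * ψ (r * A) + (s₂ * ψ (-(r * A)) +
        (t₁ * ψ (r * B) + t₂ * ψ (-(r * B)))))) =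
    1 * δ (2 * r * q) + (2 * n * δ (r * q) + (2 * e₂ * δ (r * (q - A)) +
      (2 * e₁ * δ (r * (q + A)) + ((2 * n * e₁ + 2 * N * s₀ * s₁) * δ (r * A) +
      (2 * N * s₀ * t₁ * δ (r * B) + ((e₁ ^ 2 + N * s₁ ^ 2) * δ (2 * r * A) +
      (N * t₁ ^ 2 * δ (2 * r * B) + ((2 * n * e₂ + 2 * N * s₀ * s₂) * δ (-(r * A)) +
      (2 * N * s₀ * t₂ * δ (-(r * B)) + ((e₂ ^ 2 + N * s₂ ^ 2) * δ (-(2 * r * A)) +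
      (N * t₂ ^ 2 * δ (-(2 * r * B)) + (2 * N * s₁ * t₁ * δ (r * (A + B)) +
      (2 * N * s₁ * t₂ * δ (r * (A - B)) + (2 * N * s₂ * t₁ * δ (r * (-A + B)) +
      (2 * N * s₂ * t₂ * δ (r * (-A - B)) +
      ((n ^ 2 + 2 * e₁ * e₂ + N * s₀ ^ 2 + 2 * N * (s₁ * s₂ + t₁ * t₂)) * δ 0 +
        0)))))))))))))))) := by
  -- Sums of two values of `D` are normalized to the forms listed in the table, so that equal terms
  -- can be collected.
  have h1 : r * q + r * q = 2 * r * q := by ring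
  have h2 : r * q + r * A = r * (q + A) := by ring
  have h3 : r * q + -(r * A) = r * (q - A) := by ring
  have h4 : r * A + r * q = r * (q + A) := by ring
  have h5 : -(r * A) + r * q = r * (q - A) := by ring
  have h6 : r * A + r * A = 2 * r * A := by ring
  have h7 : -(r * A) + -(r * A) = -(2 * r * A) := by ring
  have h8 : r * B + r * B = 2 * r * B := by ring
  have h9 : -(r * B) + -(r * B) = -(2 * r * B) := by ring
  have h10 : r * A + r * B = r * (A + B) := by ring
  have h11 : r * B + r * A = r * (A + B) := by ring
  have h12 : r * A + -(r * B) = r * (A - B) := by ring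
  have h13 : -(r * B) + r * A = r * (A - B) := by ring
  have h14 : -(r * A) + r * B = r * (-A + B) := by ring
  have h15 : r * B + -(r * A) = r * (-A + B) := by ring
  have h16 : -(r * A) + -(r * B) = r * (-A - B) := by ring
  have h17 : -(r * B) + -(r * A) = r * (-A - B) := by ring
  simp only [hφ, hψ, add_zero, zero_add, add_neg_cancel, neg_add_cancel, h1, h2, h3, h4, h5, h6, h7,
    h8, h9, h10, h11, h12, h13, h14, h15, h16, h17]
  ring

variable {p k m : ℕ} [Fact p.Prime] {F : Type*} [Field F] [Fintype F] [Algebra (ZMod p) F]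
  {ζ : ℂ}

/-- For fixed `c` the two pairs vary independently, so the indicator of `z` is averaged twice
against the distribution of `D(·,·,c)`: once for `c = 0` and identically for each of the `p^m - 1`
other `c`. Summing rows by the indicator also handles coinciding values. -/
theorem hasValueDistribution_pairs (hp : p ≠ 2) (hm : Odd m) (hm5 : 5 ≤ m) (hmk : Nat.gcd m k = 1)
    (hF : Fintype.card F = p ^ m) (hζ : IsPrimitiveRoot ζ p) :
    HasValueDistribution (fun y : F × (F × F) × (F × F) =>
      D p k F ζ y.2.1.1 y.2.1.2 y.1 + D p k F ζ y.2.2.1 y.2.2.2 y.1) (table p m) := by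
  classical
  intro z
  set δ : ℂ → ℚ := fun d => if d = z then 1 else 0 with hδ
  have hcard : (Nat.card {y : F × (F × F) × (F × F) //
      D p k F ζ y.2.1.1 y.2.1.2 y.1 + D p k F ζ y.2.2.1 y.2.2.2 y.1 = z} : ℚ) =
      ∑ c : F, ∑ x : F × F, ∑ x' : F × F, δ (D p k F ζ x.1 x.2 c + D p k F ζ x'.1 x'.2 c) := by
    rw [Nat.card_eq_fintype_card, Fintype.card_subtype, Finset.card_filter, Nat.cast_sum,
      Fintype.sum_prod_type]
    refine Finset.sum_congr rfl fun c _ => ?_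
    rw [Fintype.sum_prod_type]
    exact Finset.sum_congr rfl fun x _ => Finset.sum_congr rfl fun x' _ => by simp [hδ]
  have hval : ((p : ℂ) - 1) * (p : ℂ) ^ ((m + 1) / 2) = valA p m := rfl
  obtain ⟨f0, f1, f2⟩ := card_D_zero (k := k) hp hm hm5 hmk hF hζ
  have hφ : ∀ d, ∑ x : F × F, δ (d + D p k F ζ x.1 x.2 0) =
      δ (d + ((p : ℂ) - 1) * p ^ m) + (n0 p m * δ (d + 0) +
        (nE p m 1 * δ (d + ((p : ℂ) - 1) * p ^ ((m + 1) / 2)) +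
          nE p m (-1) * δ (d + -(((p : ℂ) - 1) * p ^ ((m + 1) / 2))))) := by
    intro d
    rw [sum_D_comp_zero hp hm hm5 hmk hF hζ (fun t => δ (d + t)), f0, f1, f2, hval]
  have hsum : ∀ {c : F}, c ≠ 0 → ∀ g : ℂ → ℚ, ∑ x : F × F, g (D p k F ζ x.1 x.2 c) =
      n0s p m * g 0 + (nE1 p m 1 * g (((p : ℂ) - 1) * p ^ ((m + 1) / 2)) +
        (nE1 p m (-1) * g (-(((p : ℂ) - 1) * p ^ ((m + 1) / 2))) +
        (nE3 p m 1 * g (((p : ℂ) - 1) * p ^ ((m + 3) / 2)) +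
          nE3 p m (-1) * g (-(((p : ℂ) - 1) * p ^ ((m + 3) / 2)))))) := by
    intro c hc g
    obtain ⟨g0, g1, g2, g3, g4⟩ := card_D_ne_zero (k := k) hp hm hm5 hmk hF hζ hc
    rw [sum_D_comp_ne_zero hp hm hmk hF hζ hc g, g0, g1, g2, g3, g4, hval, mul_valA]
  set ψ : ℂ → ℚ := fun d => n0s p m * δ (d + 0) +
      (nE1 p m 1 * δ (d + ((p : ℂ) - 1) * p ^ ((m + 1) / 2)) +
        (nE1 p m (-1) * δ (d + -(((p : ℂ) - 1) * p ^ ((m + 1) / 2))) +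
        (nE3 p m 1 * δ (d + ((p : ℂ) - 1) * p ^ ((m + 3) / 2)) +
          nE3 p m (-1) * δ (d + -(((p : ℂ) - 1) * p ^ ((m + 3) / 2)))))) with hψ
  have hout : ∀ c ∈ ({0}ᶜ : Finset F), ∑ x : F × F, ∑ x' : F × F,
      δ (D p k F ζ x.1 x.2 c + D p k F ζ x'.1 x'.2 c) =
      n0s p m * ψ 0 + (nE1 p m 1 * ψ (((p : ℂ) - 1) * p ^ ((m + 1) / 2)) +
        (nE1 p m (-1) * ψ (-(((p : ℂ) - 1) * p ^ ((m + 1) / 2))) +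
        (nE3 p m 1 * ψ (((p : ℂ) - 1) * p ^ ((m + 3) / 2)) +
          nE3 p m (-1) * ψ (-(((p : ℂ) - 1) * p ^ ((m + 3) / 2)))))) := by
    intro c hc
    have hc0 : c ≠ 0 := by simpa using hc
    -- `ψ` is the result of the inner sum; the same formula, applied to `ψ`, evaluates the outer
    -- sum.
    rw [← hsum hc0 ψ]
    exact Finset.sum_congr rfl fun x _ => hsum hc0 (fun t => δ (D p k F ζ x.1 x.2 c + t))
  have hzero := sum_D_comp_zero hp hm hm5 hmk hF hζ
    (fun d => ∑ x' : F × F, δ (d + D p k F ζ x'.1 x'.2 0))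
  rw [f0, f1, f2, ← hval] at hzero
  rw [hcard, Fintype.sum_eq_add_sum_compl 0, hzero, Finset.sum_congr rfl hout, Finset.sum_const,
    Finset.card_compl, Finset.card_singleton, nsmul_eq_mul, hF,
    Nat.cast_sub (Nat.one_le_pow m p (Fact.out : p.Prime).pos), Nat.cast_pow, Nat.cast_one,
    convolution_eq δ _ _ _ _ _ _ _ _ _ _ _ _ _ hφ (fun d => rfl)]
  have hite : ∀ (c : ℂ) (t : ℚ), (if c = z then t else 0) = t * δ c := by
    intro c t
    simp [hδ]
  simp only [table, List.map_cons, List.map_nil, List.sum_cons, List.sum_nil, hite]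
  push_cast
  rfl

theorem HasValueDistribution.of_equiv {X Y : Type*} {f : X → ℂ} {g : Y → ℂ} {t : List (ℤ × ℚ)}
    (h : HasValueDistribution g t) (e : X ≃ Y) (hfg : ∀ x, f x = g (e x)) :
    HasValueDistribution f t := by
  intro z
  rw [← h z, Nat.card_congr (e.subtypeEquiv (q := fun y => g y = z) fun x => by rw [hfg x])]

/-- The change of variables `(a₁,a₂,b₁,b₂,c) ↦ (c, (a₁+a₂, b₁+b₂), (a₁-a₂, b₁-b₂))`. -/
def sumDiffEquiv {F : Type*} [Field F] (h2 : (2 : F) ≠ 0) :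
    F × F × F × F × F ≃ F × (F × F) × (F × F) where
  toFun x := (x.2.2.2.2, (x.1 + x.2.1, x.2.2.1 + x.2.2.2.1), (x.1 - x.2.1, x.2.2.1 - x.2.2.2.1))
  invFun y := ((y.2.1.1 + y.2.2.1) / 2, (y.2.1.1 - y.2.2.1) / 2, (y.2.1.2 + y.2.2.2) / 2,
    (y.2.1.2 - y.2.2.2) / 2, y.1)
  left_inv := by
    rintro ⟨a₁, a₂, b₁, b₂, c⟩
    simp only [Prod.mk.injEq, and_true]
    refine ⟨?_, ?_, ?_, ?_⟩ <;> field_simp <;> ring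
  right_inv := by
    rintro ⟨c, ⟨u, v⟩, ⟨u', v'⟩⟩
    simp only [Prod.mk.injEq, true_and]
    refine ⟨⟨?_, ?_⟩, ?_, ?_⟩ <;> field_simp <;> ring

/-- The change of variables that negates `v'`. -/
def negLastEquiv (F : Type*) [Field F] : F × (F × F) × (F × F) ≃ F × (F × F) × (F × F) :=
  (Equiv.refl F).prodCongr ((Equiv.refl (F × F)).prodCongr ((Equiv.refl F).prodCongr (Equiv.neg F)))

omit [Fact p.Prime] in
-- After division by `a = (p-1) p^((m+1)/2)` the values are small expressions in `p` and `X =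
-- p^((m-1)/2)`. Since `p ≥ 5` and `X ≥ 5p`, linear arithmetic separates them; at `p = 3` the
-- entries `p - 1` and 2 would coincide.
theorem table_nodup (hpp : p.Prime) (hp : p ≠ 2) (hp3 : p ≠ 3) (hm : Odd m) (hm5 : 5 ≤ m) :
    ((table p m).map Prod.fst).Nodup := by
  have hp5 : 5 ≤ p := by
    by_contra! h
    have := hpp.two_le
    interval_cases p <;> first | omega | exact absurd hpp (by decide)
  obtain ⟨n, rfl⟩ := hm
  have hn : 2 ≤ n := by omega
  have hA : 0 < ((p : ℤ) - 1) * (p : ℤ) ^ (n + 1) := by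
    have : (5 : ℤ) ≤ p := by exact_mod_cast hp5
    exact mul_pos (by linarith) (by positivity)
  set a : ℤ := ((p : ℤ) - 1) * (p : ℤ) ^ (n + 1) with ha
  obtain ⟨X, hX, hX5⟩ : ∃ X : ℤ, (p : ℤ) ^ n = X ∧ 5 * (p : ℤ) ≤ X := by
    refine ⟨_, rfl, ?_⟩
    have h1 : (p : ℤ) ^ 2 ≤ (p : ℤ) ^ n := pow_le_pow_right₀ (by exact_mod_cast hpp.one_le) hn
    have h2 : (5 : ℤ) ≤ p := by exact_mod_cast hp5
    nlinarith
  have hmap : (table p (2 * n + 1)).map Prod.fst =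
      [2 * X, X, X - 1, X + 1, 1, (p : ℤ), 2, 2 * p, -1, -p, -2, -(2 * p), 1 + p, 1 - p, -1 + p,
        -1 - p, 0].map (a * ·) := by
    have e1 : (p : ℤ) ^ (2 * n + 1) = (p : ℤ) ^ (n + 1) * X := by rw [← hX, ← pow_add]; congr 1; omega
    have e2 : (p : ℤ) ^ ((2 * n + 1 + 3) / 2) = (p : ℤ) ^ (n + 1) * p := by
      rw [← pow_succ]; congr 1; omega
    have e3 : (2 * n + 1 + 1) / 2 = n + 1 := by omega
    simp only [table, List.map_cons, List.map_nil, e1, e2, e3, ha]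
    simp only [List.cons.injEq, and_true]
    refine ⟨?_, ?_, ?_, ?_, ?_, ?_, ?_, ?_, ?_, ?_, ?_, ?_, ?_, ?_, ?_, ?_, ?_⟩ <;> ring
  rw [hmap]
  refine List.Nodup.map (mul_right_injective₀ hA.ne') ?_
  have hp5' : (5 : ℤ) ≤ p := by exact_mod_cast hp5
  simp only [List.nodup_cons, List.mem_cons, List.not_mem_nil, or_false, not_or, not_false_eq_true,
    List.nodup_nil, and_true]
  refine ⟨?_, ?_, ?_, ?_, ?_, ?_, ?_, ?_, ?_, ?_, ?_, ?_, ?_, ?_, ?_, ?_⟩ <;> omega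

end Table

end FiveZeros

end

/-! ### The main theorem. -/

theorem theorem4p3 (p m k : ℕ) [Fact p.Prime] (hp : p ≠ 2) (hm : Odd m) (hm5 : 5 ≤ m)
    (hk : 0 < k) (hmk : Nat.gcd m k = 1)
    (F : Type*) [Field F] [Fintype F] [Algebra (ZMod p) F] (hF : Fintype.card F = p ^ m)
    (ζ : ℂ) (hζ : IsPrimitiveRoot ζ p) :
    -- the numbers that occur in the table count the solutions of `D(u,v,w) = const`
    ((Nat.card {uv : F × F // FiveZeros.D p k F ζ uv.1 uv.2 0 = 0} : ℚ) = FiveZeros.n0 p m ∧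
      (∀ ε : ℤ, ε = 1 ∨ ε = -1 →
        (Nat.card {uv : F × F // FiveZeros.D p k F ζ uv.1 uv.2 0 =
          ε * ((p : ℂ) - 1) * (p : ℂ) ^ ((m + 1) / 2)} : ℚ) = FiveZeros.nE p m ε) ∧
      ∀ w : F, w ≠ 0 →
        (Nat.card {uv : F × F // FiveZeros.D p k F ζ uv.1 uv.2 w = 0} : ℚ) = FiveZeros.n0s p m ∧
        ∀ ε : ℤ, ε = 1 ∨ ε = -1 →
          (Nat.card {uv : F × F // FiveZeros.D p k F ζ uv.1 uv.2 w =
            ε * ((p : ℂ) - 1) * (p : ℂ) ^ ((m + 1) / 2)} : ℚ) = FiveZeros.nE1 p m ε ∧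
          (Nat.card {uv : F × F // FiveZeros.D p k F ζ uv.1 uv.2 w =
            ε * ((p : ℂ) - 1) * (p : ℂ) ^ ((m + 3) / 2)} : ℚ) = FiveZeros.nE3 p m ε) ∧
    -- the value distribution of `S` for even `k`
    (Even k → FiveZeros.HasValueDistribution
      (fun x : F × F × F × F × F =>
        FiveZeros.S p k F ζ x.1 x.2.1 x.2.2.1 x.2.2.2.1 x.2.2.2.2) (FiveZeros.table p m)) ∧
    -- the value distribution of `T` for odd `k`
    (Odd k → FiveZeros.HasValueDistribution
      (fun x : F × F × F × F × F =>
        FiveZeros.T p k F ζ x.1 x.2.1 x.2.2.1 x.2.2.2.1 x.2.2.2.2) (FiveZeros.table p m)) ∧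
    -- the seventeen listed values are pairwise distinct, unless `p = 3`
    (p ≠ 3 → ((FiveZeros.table p m).map Prod.fst).Nodup) := by
  have hval : ((p : ℂ) - 1) * (p : ℂ) ^ ((m + 1) / 2) = FiveZeros.valA p m := rfl
  have hval3 : ((p : ℂ) - 1) * (p : ℂ) ^ ((m + 3) / 2) = p * FiveZeros.valA p m :=
    FiveZeros.mul_valA.symm
  have hpairs := FiveZeros.hasValueDistribution_pairs (k := k) hp hm hm5 hmk hF hζ
  have h2 := FiveZeros.two_ne_zero_of_ne F hp
  refine ⟨⟨?_, ?_, ?_⟩, fun _ => ?_, fun _ => ?_, fun hp3 => ?_⟩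
  · exact (FiveZeros.card_D_zero (k := k) hp hm hm5 hmk hF hζ).1
  · rintro ε (rfl | rfl)
    · simp only [hval, Int.cast_one, one_mul]
      exact (FiveZeros.card_D_zero (k := k) hp hm hm5 hmk hF hζ).2.1
    · simp only [hval, Int.cast_neg, Int.cast_one, neg_mul, one_mul]
      exact (FiveZeros.card_D_zero (k := k) hp hm hm5 hmk hF hζ).2.2
  · intro w hw
    obtain ⟨g0, g1, g2, g3, g4⟩ := FiveZeros.card_D_ne_zero (k := k) hp hm hm5 hmk hF hζ hw
    refine ⟨g0, ?_⟩
    rintro ε (rfl | rfl)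
    · simp only [hval, hval3, Int.cast_one, one_mul]
      exact ⟨g1, g3⟩
    · simp only [hval, hval3, Int.cast_neg, Int.cast_one, neg_mul, one_mul]
      exact ⟨g2, g4⟩
  · exact hpairs.of_equiv (FiveZeros.sumDiffEquiv h2) fun _ => rfl
  -- `T` differs from `S` only in the sign of the second `v`-argument, a bijection of the parameter
  -- space.
  · exact hpairs.of_equiv ((FiveZeros.sumDiffEquiv h2).trans (FiveZeros.negLastEquiv F)) fun _ => rfl
  · exact FiveZeros.table_nodup Fact.out hp hp3 hm hm5
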